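/- For $\alpha,\theta\in(0,1]$ let $H_{\alpha,\theta}$ be the almost Mathieu operator on $\ell^2(\mathbb Z)$ at critical coupling, $$(H_{\alpha,\theta}\phi)(n)=\phi(n-1)+\phi(n+1)+2\cos 2\pi(\alpha n+\theta)\,\phi(n),$$ and let $S(\alpha)$ be the union over $\theta\in(0,1]$ of the spectra of $H_{\alpha,\theta}$. For coprime positive integers $p,q$ let $$\sigma(E)=-\operatorname{tr}\prod_{j=1}^{q}\begin{pmatrix}E-2\cos\!\left(\frac{2\pi jp}{q}+\frac{\pi}{2q}\right)&-1\\1&0\end{pmatrix}$$ (factors ordered from left to right by increasing $j$) be the discriminant. For odd $q$, $S(p/q)$ is symmetric about $0$ and consists of $q$ disjoint compact intervals (bands); let $w_0$ denote half the width of the centermost band, i.e. of the connected component of $S(p/q)$ containing $0$. Write $[a_1,\dots,a_k]=\cfrac{1}{a_1+\cfrac{1}{a_2+\cdots+\cfrac1{a_k}}}$, and let $q_k$ be the denominator of $[a_1,\dots,a_k]$ in lowest terms. There exist absolute constants $1<C_1<14$ and $1<C_2<e^{10}$ such that the following holds. Let $n\ge1$, let $a_1,\dots,a_n$ be positive integers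 with $a_1$ odd and $a_k$ even for $2\le k\le n$, and let $p/q=[a_1,\dots,a_n]$ with $p,q$ coprime positive integers (so $q=q_n$ is odd). Then $$|\sigma'(0)|<C_2\,q^{C_1}\qquad\text{and}\qquad w_0\ \ge\ \frac{4}{|\sigma'(0)|}\ >\ 4C_2^{-1}q^{-C_1}.$$ Moreover, for every $\nu>1$ and every $\varepsilon>0$ there exists $Q=Q(\varepsilon,\nu)$ such that for all $n$, $a_1,\dots,a_n$, $p/q$ as above which in addition satisfy $q_{k+1}\ge q_k^{\nu}$ for all $1\le k\le n-1$, if $q>Q$ then $$|\sigma'(0)|<q^{5+\gamma_0+\varepsilon}\qquad\text{and}\qquad w_0>4q^{-(5+\gamma_0+\varepsilon)},$$ where $\gamma_0$ is Euler's constant. -/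

import Mathlib

open scoped ENNReal

noncomputable section

namespace AlmostMathieu

/-! ### The almost Mathieu operator and its spectrum -/

/-- The Hilbert space `ℓ²(ℤ)`. -/
abbrev Ell2 : Type := lp (fun _ : ℤ => ℂ) 2

theorem memℓp_shift (k : ℤ) (f : Ell2) : Memℓp (fun n : ℤ => f (n + k)) 2 := by
  have h2 : (0 : ℝ) < (2 : ℝ≥0∞).toReal := by norm_num
  refine (memℓp_gen_iff h2).2 ?_
  exact (Equiv.addRight k).summable_iff.2 ((memℓp_gen_iff h2).1 (lp.memℓp f))

/-- Translation by `k` on `ℓ²(ℤ)`: `(shift k f)(n) = f(n + k)`. -/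
def shift (k : ℤ) : Ell2 →L[ℂ] Ell2 :=
  LinearMap.mkContinuous
    { toFun := fun f => ⟨fun n : ℤ => f (n + k), memℓp_shift k f⟩
      map_add' := fun _ _ => rfl
      map_smul' := fun _ _ => rfl } 1 (by
    intro f
    have h2 : (0 : ℝ) < (2 : ℝ≥0∞).toReal := by norm_num
    rw [one_mul]
    refine lp.norm_le_of_tsum_le h2 (norm_nonneg _) ?_
    rw [lp.norm_rpow_eq_tsum h2 f]
    exact ((Equiv.addRight k).tsum_eq fun n : ℤ => ‖f n‖ ^ (2 : ℝ≥0∞).toReal).le)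

/-- The potential `2 cos 2π(αn + θ)`. -/
def potential (α θ : ℝ) (n : ℤ) : ℝ := 2 * Real.cos (2 * Real.pi * (α * n + θ))

theorem norm_potential_mul_le (α θ : ℝ) (n : ℤ) (z : ℂ) :
    ‖(potential α θ n : ℂ) * z‖ ≤ ‖(2 : ℂ) * z‖ := by
  rw [norm_mul, norm_mul]
  refine mul_le_mul_of_nonneg_right ?_ (norm_nonneg z)
  rw [Complex.norm_real, Complex.norm_ofNat, potential, Real.norm_eq_abs, abs_mul, abs_two]
  have := Real.abs_cos_le_one (2 * Real.pi * (α * n + θ))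
  linarith

theorem memℓp_potential_mul (α θ : ℝ) (f : Ell2) :
    Memℓp (fun n : ℤ => (potential α θ n : ℂ) * f n) 2 :=
  ((lp.memℓp f).const_mul (2 : ℂ)).mono' fun n => norm_potential_mul_le α θ n (f n)

/-- Multiplication by the potential on `ℓ²(ℤ)`. -/
def mulPotential (α θ : ℝ) : Ell2 →L[ℂ] Ell2 :=
  LinearMap.mkContinuous
    { toFun := fun f => ⟨fun n : ℤ => (potential α θ n : ℂ) * f n, memℓp_potential_mul α θ f⟩
      map_add' := fun f g => by
        ext n
        exact mul_add _ _ _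
      map_smul' := fun c f => by
        ext n
        exact mul_left_comm _ _ _ } 2 (by
    intro f
    have h : ‖(2 : ℂ) • f‖ = 2 * ‖f‖ := by rw [norm_smul, Complex.norm_ofNat]
    rw [← h]
    exact lp.norm_mono (by norm_num) fun n => norm_potential_mul_le α θ n (f n))

/-- The almost Mathieu operator `H_{α,θ}` on `ℓ²(ℤ)` (critical coupling). -/
def operator (α θ : ℝ) : Ell2 →L[ℂ] Ell2 := shift (-1) + shift 1 + mulPotential α θ

/-- `(H_{α,θ} φ)(n) = φ(n - 1) + φ(n + 1) + 2 cos 2π(αn + θ) φ(n)`. -/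
theorem operator_apply (α θ : ℝ) (φ : Ell2) (n : ℤ) :
    operator α θ φ n
      = φ (n - 1) + φ (n + 1)
        + ((2 * Real.cos (2 * Real.pi * (α * n + θ)) : ℝ) : ℂ) * φ n :=
  rfl

/-- `S(α)`: the union over `θ ∈ (0,1]` of the spectra of `H_{α,θ}`
(which are real, `H_{α,θ}` being self-adjoint). -/
def S (α : ℝ) : Set ℝ :=
  {E : ℝ | ∃ θ ∈ Set.Ioc (0 : ℝ) 1, (E : ℂ) ∈ spectrum ℂ (operator α θ)}

/-- The centermost band of `S(α)`, for `α = p/q` with `q` odd: `S(p/q)` is symmetric about `0`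
and is the union of `q` disjoint compact intervals (the bands), the middle one of which is centred
at `0`; it is the connected component of `0` in `S(p/q)`. -/
def centralBand (α : ℝ) : Set ℝ := connectedComponentIn (S α) 0

/-- `w₀`: half the width (length) of the centermost band. -/
def halfWidth (α : ℝ) : ℝ := Metric.diam (centralBand α) / 2

/-! ### The discriminant -/

/-- The transfer matrix with entry `E - 2 cos(2πjp/q + π/(2q))`. -/
def transferMatrix (p q : ℕ) (E : ℝ) (j : ℕ) : Matrix (Fin 2) (Fin 2) ℝ :=
  !![E - 2 * Real.cos (2 * Real.pi * j * p / q + Real.pi / (2 * q)), -1; 1, 0]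

/-- The discriminant `σ(E)` for `p/q`: minus the trace of the product, in this order, of the
transfer matrices with `j = 1, 2, …, q`. -/
def discriminant (p q : ℕ) (E : ℝ) : ℝ :=
  -(((List.range q).map fun i => transferMatrix p q E (i + 1)).prod).trace

/-! ### Continued fractions -/

/-- `cfrac a n = [a₁, a₂, …, aₙ] = 1/(a₁ + 1/(a₂ + ⋯ + 1/aₙ))`; the value `a 0` is not used. -/
def cfrac : (ℕ → ℕ) → ℕ → ℚ
  | _, 0 => 0
  | a, n + 1 => 1 / (a 1 + cfrac (fun k => a (k + 1)) n)

/-- The denominator `qₖ` of `[a₁, …, aₖ]` in lowest terms. -/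
def convDen (a : ℕ → ℕ) (k : ℕ) : ℕ := (cfrac a k).den

end AlmostMathieu

end

/-!
Fix `α = p / q`. By Chambers' formula (`chambers`, `trace_monodromy_phase`) the trace of the
monodromy matrix at the phase `θ` is `-σ(E) - 2 cos 2πqθ`. Hence every complex `E` with
`σ(E) ∈ [-4, 4]` carries a Bloch solution with a multiplier of modulus one at some phase. Such a
solution forces `E` to be real (`im_eq_zero_of_bloch`), so
that `σ - c` is real-rooted for `|c| ≤ 4`, and Laguerre's inequality gives `|σ| ≥ 4` at the critical
points of `σ` (`four_le_abs_of_critical`). As `σ` is odd with simple real zeros, it lies below its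
tangent at `0` up to its first positive zero, so `|σ(E)| ≤ 4` for `|E| ≤ 4 / |σ'(0)|`
(`abs_discPoly_le_four`). Truncated Bloch solutions are approximate eigenvectors, so this interval
is contained in `S(α)`, which is the lower bound for the width of the central band (`le_halfWidth`).

For the upper bound of `|σ'(0)|`, multiplication by a quadratic phase followed by a discrete Fourier
transform carries the operator to a Jacobi chain with zero diagonal and hopping amplitudes
`2 sin πjα`, which break at `j = q`. Comparing zeros, `-σ` is the characteristic polynomial
`chainPoly` of this chain (`discPoly_eq_chainPoly`). The three-term recurrence expresses its slope
at `0` as a sum of quotients of products of the squared amplitudes over odd and over even `j`,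
times `∏ (2 sin 2πlα)² = q` (`chainPoly_derivative_eval_zero`, `evenProd_eq`). The logarithms of
the quotients are twice the sums `-∑ (-1)^j log |sin πjα|` over `1 ≤ j ≤ 2i`.

These sums are controlled by renormalization. An alternating analogue of the double sine function,
built from the Gamma quotient `altLog`, solves the two difference equations that turn an
alternating Birkhoff sum of `log |tan (πx/2)|` along the rotation by `b` into one along the rotation
by `1 / b`, up to a correction of at most `log (1 / b)` plus a constant (`abs_altSum_le`). The first
step, from `log |sin πx|` to `log |tan (πx/2)|`, is similar and costs only a constant
(`neg_sineSum_le`). Since `log |tan (πx/2)|` has period `2`, even partial quotients may be dropped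
after each inversion, and the corrections `log (1 / b)` along the continued fraction telescope to at
most `log q`. The result is `|σ'(0)| ≤ 6 · 15^(n-1) · q^4` (`slope_and_width`). Finally
`2^(n-1) ≤ q` (`two_pow_le_den`), and `15^n = O(q)` if the denominators grow superexponentially
(`exists_pow_le_mul_den`).
-/

namespace AlmostMathieu

open Filter Topology Finset

/-! ### A Gamma quotient and its difference equations -/

/-- The function `log Γ(t/2w + 1/2) - log Γ(t/2w) + log(2w)/2`: the solution of
`g(t) + g(t + w) = log t` on `(0, ∞)` that is increasing and concave, i.e. the regularized
alternating sum `∑ (-1)^i log (t + i w)`. -/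
noncomputable def altLog (w t : ℝ) : ℝ :=
  Real.log (Real.Gamma (t / (2 * w) + 1 / 2)) - Real.log (Real.Gamma (t / (2 * w)))
    + Real.log (2 * w) / 2

theorem altLog_add {w t : ℝ} (hw : 0 < w) (ht : 0 < t) :
    altLog w t + altLog w (t + w) = Real.log t := by
  have hx : 0 < t / (2 * w) := by positivity
  have h1 : (t + w) / (2 * w) = t / (2 * w) + 1 / 2 := by field_simp
  have h2 : t / (2 * w) + 1 / 2 + 1 / 2 = t / (2 * w) + 1 := by ring
  have h3 : Real.log (t / (2 * w)) = Real.log t - Real.log (2 * w) :=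
    Real.log_div ht.ne' (by positivity)
  unfold altLog
  rw [h1, h2, Real.Gamma_add_one hx.ne', Real.log_mul hx.ne' (Real.Gamma_pos_of_pos hx).ne', h3]
  ring

theorem altLog_reflect {w t : ℝ} (hw : 0 < w) (ht : 0 < t) (htw : t < w) :
    altLog w t - altLog w (w - t) = Real.log (Real.tan (Real.pi * t / (2 * w))) := by
  set x := t / (2 * w) with hx
  have hx0 : 0 < x := by positivity
  have hx1 : x < 1 / 2 := by rw [hx, div_lt_div_iff₀ (by positivity) two_pos]; linarith
  have h1 : (w - t) / (2 * w) = 1 / 2 - x := by rw [hx]; field_simp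
  have h2 : Real.pi * t / (2 * w) = Real.pi * x := by rw [hx]; ring
  have hs : 0 < Real.sin (Real.pi * x) :=
    Real.sin_pos_of_pos_of_lt_pi (by positivity) (by nlinarith [Real.pi_pos])
  have hc : 0 < Real.cos (Real.pi * x) :=
    Real.cos_pos_of_mem_Ioo ⟨by nlinarith [Real.pi_pos], by nlinarith [Real.pi_pos]⟩
  have r1 := Real.Gamma_mul_Gamma_one_sub x
  have r2 := Real.Gamma_mul_Gamma_one_sub (x + 1 / 2)
  rw [show Real.pi * (x + 1 / 2) = Real.pi * x + Real.pi / 2 by ring, Real.sin_add_pi_div_two,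
    show 1 - (x + 1 / 2) = 1 / 2 - x by ring] at r2
  have p1 := Real.Gamma_pos_of_pos hx0
  have p2 := Real.Gamma_pos_of_pos (show 0 < 1 - x by linarith)
  have p3 := Real.Gamma_pos_of_pos (show 0 < x + 1 / 2 by linarith)
  have p4 := Real.Gamma_pos_of_pos (show 0 < 1 / 2 - x by linarith)
  have l1 := congrArg Real.log r1
  have l2 := congrArg Real.log r2
  rw [Real.log_mul p1.ne' p2.ne', Real.log_div Real.pi_ne_zero hs.ne'] at l1
  rw [Real.log_mul p3.ne' p4.ne', Real.log_div Real.pi_ne_zero hc.ne'] at l2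
  unfold altLog
  rw [← hx, h1, h2, Real.tan_eq_sin_div_cos, Real.log_div hs.ne' hc.ne',
    show 1 / 2 - x + 1 / 2 = 1 - x by ring]
  linarith

theorem tendsto_log_Gamma_half {x : ℝ} (hx : 0 < x) :
    Tendsto (fun n : ℕ => Real.log n / 2 + ∑ m ∈ range (n + 1),
      (Real.log (x + m) - Real.log (x + 1 / 2 + m))) atTop
      (𝓝 (Real.log (Real.Gamma (x + 1 / 2)) - Real.log (Real.Gamma x))) := by
  refine ((Real.BohrMollerup.tendsto_log_gamma (by positivity : 0 < x + 1 / 2)).sub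
    (Real.BohrMollerup.tendsto_log_gamma hx)).congr fun n => ?_
  simp only [Real.BohrMollerup.logGammaSeq, sum_sub_distrib]
  ring

theorem altLog_mono {w s t : ℝ} (hw : 0 < w) (hs : 0 < s) (hst : s ≤ t) :
    altLog w s ≤ altLog w t := by
  have hx : 0 < s / (2 * w) := by positivity
  have hxy : s / (2 * w) ≤ t / (2 * w) := by gcongr
  refine add_le_add_left (le_of_tendsto_of_tendsto' (tendsto_log_Gamma_half hx)
    (tendsto_log_Gamma_half (hx.trans_le hxy)) fun n => ?_) _
  refine add_le_add le_rfl (sum_le_sum fun m _ => ?_)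
  set x := s / (2 * w)
  set y := t / (2 * w)
  have hm : (0 : ℝ) ≤ m := m.cast_nonneg
  rw [← Real.log_div (by positivity) (by positivity),
    ← Real.log_div (by linarith) (by linarith)]
  apply Real.log_le_log (by positivity)
  rw [div_le_div_iff₀ (by positivity) (by linarith)]
  nlinarith

/-- Concavity of `altLog`, in the form in which it is used: increments decrease. -/
theorem altLog_increment_le {w s t d : ℝ} (hw : 0 < w) (hs : 0 < s) (hst : s ≤ t) (hd : 0 ≤ d) :
    altLog w (t + d) - altLog w t ≤ altLog w (s + d) - altLog w s := by
  have hx : 0 < s / (2 * w) := by positivity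
  have hxy : s / (2 * w) ≤ t / (2 * w) := by gcongr
  have he : 0 ≤ d / (2 * w) := by positivity
  unfold altLog
  rw [add_div, add_div]
  set x := s / (2 * w)
  set y := t / (2 * w)
  set e := d / (2 * w)
  have hy : 0 < y := hx.trans_le hxy
  have key := le_of_tendsto_of_tendsto'
    ((tendsto_log_Gamma_half (show 0 < y + e by positivity)).sub (tendsto_log_Gamma_half hy))
    ((tendsto_log_Gamma_half (show 0 < x + e by positivity)).sub (tendsto_log_Gamma_half hx))
    fun n => ?_
  · linarith
  · rw [add_sub_add_left_eq_sub, add_sub_add_left_eq_sub, ← sum_sub_distrib, ← sum_sub_distrib]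
    refine sum_le_sum fun m _ => ?_
    have hm : (0 : ℝ) ≤ m := m.cast_nonneg
    have hX : 0 < x + m := by positivity
    have hXY : x + m ≤ y + m := by linarith
    rw [show y + e + m = (y + m) + e by ring, show x + e + m = (x + m) + e by ring,
      show y + e + 1 / 2 + m = (y + m) + (e + 1 / 2) by ring,
      show x + e + 1 / 2 + m = (x + m) + (e + 1 / 2) by ring,
      show y + 1 / 2 + m = (y + m) + 1 / 2 by ring, show x + 1 / 2 + m = (x + m) + 1 / 2 by ring]
    set X := x + m
    set Y := y + m
    have hY : 0 < Y := hX.trans_le hXY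
    rw [← Real.log_div (by positivity) (by positivity),
      ← Real.log_div (by positivity) (by positivity),
      ← Real.log_div (by positivity) (by positivity),
      ← Real.log_div (by positivity) (by positivity),
      ← Real.log_div (by positivity) (by positivity),
      ← Real.log_div (by positivity) (by positivity)]
    apply Real.log_le_log (by positivity)
    have e1 : ∀ Z : ℝ, 0 < Z → (Z + e) / (Z + (e + 1 / 2)) / (Z / (Z + 1 / 2))
        = 1 + e / 2 / (Z * (Z + (e + 1 / 2))) := by
      intro Z hZ
      field_simp
      ring
    rw [e1 X hX, e1 Y hY]
    gcongr

theorem altLog_le {w t : ℝ} (hw : 0 < w) (ht : 0 < t) : altLog w t ≤ Real.log t / 2 := by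
  have h1 := altLog_add hw ht
  have h2 := altLog_mono hw ht (show t ≤ t + w by linarith)
  linarith

theorem le_altLog {w t : ℝ} (hw : 0 < w) (ht : 0 < t) :
    Real.log t - Real.log (t + w) / 2 ≤ altLog w t := by
  have h1 := altLog_add hw ht
  have h2 := altLog_le hw (show 0 < t + w by linarith)
  linarith

theorem tendsto_altLog_sub {w s t : ℝ} (hw : 0 < w) (hs : 0 < s) (ht : 0 < t) :
    Tendsto (fun n : ℕ => altLog w (t + n) - altLog w (s + n)) atTop (𝓝 0) := by
  have key : ∀ c : ℝ, Tendsto (fun n : ℕ => Real.log (n + c) - Real.log n) atTop (𝓝 0) := by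
    intro c
    have := (Real.tendsto_log_comp_add_sub_log c).comp tendsto_natCast_atTop_atTop
    exact this
  have up : ∀ s t : ℝ, 0 < s → 0 < t → ∀ n : ℕ, altLog w (t + n) - altLog w (s + n) ≤
      Real.log (n + t) / 2 - (Real.log (n + s) - Real.log (n + (s + w)) / 2) := by
    intro s t hs ht n
    have hn : (0 : ℝ) ≤ n := n.cast_nonneg
    have h1 := altLog_le hw (show 0 < t + n by linarith)
    have h2 := le_altLog hw (show 0 < s + n by linarith)
    rw [show s + n + w = n + (s + w) by ring, add_comm s (n : ℝ)] at h2
    rw [add_comm t (n : ℝ)] at h1 ⊢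
    rw [add_comm s (n : ℝ)]
    linarith
  have lim : ∀ s t : ℝ, Tendsto (fun n : ℕ => Real.log (n + t) / 2 -
      (Real.log (n + s) - Real.log (n + (s + w)) / 2)) atTop (𝓝 0) := by
    intro s t
    have := ((key t).div_const 2).sub ((key s).sub ((key (s + w)).div_const 2))
    simp only [zero_div, sub_zero] at this
    exact this.congr fun n => by ring
  refine tendsto_of_tendsto_of_tendsto_of_le_of_le (by simpa using (lim t s).neg) (lim s t)
    (fun n => ?_) (up s t hs ht)
  have := up t s ht hs n
  simp only
  linarith

/-! ### The logarithm of the tangent -/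

/-- `log |tan (π x / 2)|`; the junk value `0` at the integers is harmless. -/
noncomputable def logTan (x : ℝ) : ℝ := Real.log (Real.tan (Real.pi * x / 2))

theorem logTan_neg (x : ℝ) : logTan (-x) = logTan x := by
  unfold logTan
  rw [mul_neg, neg_div, Real.tan_neg, Real.log_neg_eq_log]

theorem logTan_add_one (x : ℝ) : logTan (x + 1) = -logTan x := by
  unfold logTan
  rw [show Real.pi * (x + 1) / 2 = Real.pi / 2 - -(Real.pi * x / 2) by ring,
    Real.tan_pi_div_two_sub, Real.tan_neg, Real.log_inv, Real.log_neg_eq_log]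

theorem logTan_add_nat (x : ℝ) (n : ℕ) : logTan (x + n) = (-1) ^ n * logTan x := by
  induction n with
  | zero => simp
  | succ n ih => rw [Nat.cast_succ, ← add_assoc, logTan_add_one, ih, pow_succ]; ring

theorem logTan_nat_sub (x : ℝ) (n : ℕ) : logTan (n - x) = (-1) ^ n * logTan x := by
  rw [← logTan_neg x, ← logTan_add_nat, neg_add_eq_sub]

/-! ### Reciprocity of alternating Birkhoff sums -/

theorem alternating_sum_mem_Icc {d : ℕ → ℝ} (hd : Antitone d) (h0 : ∀ i, 0 ≤ d i) (n : ℕ) :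
    0 ≤ ∑ i ∈ range n, (-1) ^ i * d i ∧ ∑ i ∈ range n, (-1) ^ i * d i ≤ d 0 := by
  induction n generalizing d with
  | zero => simpa using h0 0
  | succ n ih =>
    have := ih (d := fun i => d (i + 1)) (fun i j hij => hd (Nat.succ_le_succ hij))
      (fun i => h0 _)
    have h1 := hd (Nat.le_succ 0)
    rw [sum_range_succ']
    simp only [pow_succ, mul_neg, mul_one, neg_mul, sum_neg_distrib, pow_zero, one_mul] at *
    constructor <;> linarith [h0 1]

theorem sum_alternating_add_succ (a : ℕ → ℝ) (n : ℕ) :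
    ∑ i ∈ range n, (-1) ^ i * (a i + a (i + 1)) = a 0 - (-1) ^ n * a n := by
  induction n with
  | zero => simp
  | succ n ih => rw [sum_range_succ, ih, pow_succ]; ring

theorem tendsto_sum_alternating_add_succ {a : ℕ → ℝ} (ha : Tendsto a atTop (𝓝 0)) :
    Tendsto (fun n => ∑ i ∈ range n, (-1) ^ i * (a i + a (i + 1))) atTop (𝓝 (a 0)) := by
  simp only [sum_alternating_add_succ]
  have : Tendsto (fun n => (-1) ^ n * a n) atTop (𝓝 0) := by
    rw [tendsto_zero_iff_abs_tendsto_zero] at ha ⊢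
    refine ha.congr fun n => ?_
    simp [abs_mul]
  simpa using this.const_sub (a 0)

/-- Partial sums of the analogue, for the character `(-1)^(m+c)` of `ℤ²`, of the logarithm of
the double sine function with periods `1` and `b`. -/
noncomputable def doubleSine (b : ℝ) (n : ℕ) (t : ℝ) : ℝ :=
  ∑ i ∈ range n, (-1) ^ i * (altLog b (t + i) - altLog b (1 + b - t + i))

theorem abs_doubleSine_le {b t : ℝ} (hb : 0 < b) (ht : 0 < t) (ht' : t < 1 + b) (n : ℕ) :
    |doubleSine b n t| ≤ |altLog b t - altLog b (1 + b - t)| := by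
  have main : ∀ s t : ℝ, 0 < s → s ≤ t →
      |∑ i ∈ range n, (-1 : ℝ) ^ i * (altLog b (t + i) - altLog b (s + i))|
        ≤ |altLog b t - altLog b s| := by
    intro s t hs hst
    have anti : Antitone fun i : ℕ => altLog b (t + i) - altLog b (s + i) := by
      refine antitone_nat_of_succ_le fun i => ?_
      have hi : (0 : ℝ) ≤ i := i.cast_nonneg
      have := altLog_increment_le hb (show 0 < s + i by linarith)
        (show s + i ≤ s + i + 1 by linarith) (sub_nonneg.2 hst)
      rw [show s + i + 1 + (t - s) = t + (i + 1 : ℕ) by push_cast; ring,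
        show s + i + (t - s) = t + i by ring,
        show s + i + 1 = s + (i + 1 : ℕ) by push_cast; ring] at this
      exact this
    have nn : ∀ i : ℕ, 0 ≤ altLog b (t + i) - altLog b (s + i) := fun i =>
      sub_nonneg.2 (altLog_mono hb (by positivity) (by linarith))
    have := alternating_sum_mem_Icc anti nn n
    have n0 := nn 0
    simp only [Nat.cast_zero, add_zero] at this n0
    rw [abs_of_nonneg this.1, abs_of_nonneg n0]
    exact this.2
  rcases le_total (1 + b - t) t with h | h
  · exact main _ _ (by linarith) h
  · rw [abs_sub_comm, doubleSine, ← abs_neg, ← sum_neg_distrib]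
    convert main _ _ ht h using 3
    ring

theorem tendsto_doubleSine_add_period {b t : ℝ} (hb : 0 < b) (ht : 0 < t) (ht' : t < 1) :
    Tendsto (fun n => doubleSine b n t + doubleSine b n (t + b)) atTop (𝓝 (logTan t)) := by
  have h := tendsto_sum_alternating_add_succ
    (a := fun i : ℕ => altLog 1 (t + i) - altLog 1 (1 - t + i))
    (tendsto_altLog_sub one_pos (by linarith) ht)
  have h0 := altLog_reflect one_pos ht ht'
  simp only [Nat.cast_zero, add_zero, h0] at h
  rw [logTan]
  rw [mul_one] at h
  refine h.congr fun n => ?_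
  rw [doubleSine, doubleSine, ← sum_add_distrib]
  refine sum_congr rfl fun i _ => ?_
  have hi : (0 : ℝ) ≤ i := i.cast_nonneg
  have e1 := altLog_add one_pos (show 0 < t + i by linarith)
  have e2 := altLog_add one_pos (show 0 < 1 - t + i by linarith)
  have e3 := altLog_add hb (show 0 < t + i by linarith)
  have e4 := altLog_add hb (show 0 < 1 - t + i by linarith)
  rw [show 1 + b - t + (i : ℝ) = 1 - t + i + b by ring,
    show 1 + b - (t + b) + (i : ℝ) = 1 - t + i by ring, show t + b + i = t + i + b by ring]
  push_cast
  rw [← add_assoc, ← add_assoc, ← mul_add]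
  congr 1
  linarith

theorem tendsto_doubleSine_add_one {b t : ℝ} (hb : 0 < b) (ht : 0 < t) (ht' : t < b) :
    Tendsto (fun n => doubleSine b n t + doubleSine b n (t + 1)) atTop (𝓝 (logTan (t / b))) := by
  have h := tendsto_sum_alternating_add_succ
    (a := fun i : ℕ => altLog b (t + i) - altLog b (b - t + i))
    (tendsto_altLog_sub hb (by linarith) ht)
  have h0 := altLog_reflect hb ht ht'
  simp only [Nat.cast_zero, add_zero, h0] at h
  rw [logTan, show Real.pi * (t / b) / 2 = Real.pi * t / (2 * b) by field_simp]
  refine h.congr fun n => ?_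
  rw [doubleSine, doubleSine, ← sum_add_distrib]
  refine sum_congr rfl fun i _ => ?_
  push_cast
  rw [show 1 + b - t + (i : ℝ) = b - t + (i + 1) by ring,
    show 1 + b - (t + 1) + (i : ℝ) = b - t + i by ring, show t + 1 + (i : ℝ) = t + (i + 1) by ring]
  ring

/-- The lattice points `(K, L)` with `K b < L + 1` and `L < (K + 1) b` form a staircase starting
at the origin; a quantity whose increments along the staircase vanish in the limit is constant
in the limit. -/
theorem tendsto_of_staircase {b : ℝ} (hb : 0 < b) (hb1 : b ≤ 1) (Z : ℕ → ℕ → ℕ → ℝ)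
    (hK : ∀ K L : ℕ, L < (K + 1) * b → (K + 1) * b < L + 1 →
      Tendsto (fun n => Z n (K + 1) L - Z n K L) atTop (𝓝 0))
    (hL : ∀ K L : ℕ, K * b < L + 1 → (L + 1 : ℝ) < (K + 1) * b →
      Tendsto (fun n => Z n K (L + 1) - Z n K L) atTop (𝓝 0))
    (K L : ℕ) (h1 : K * b < L + 1) (h2 : L < (K + 1) * b)
    (hne : ∀ m c : ℕ, 1 ≤ m → m ≤ K → m * b ≠ c) :
    Tendsto (fun n => Z n K L - Z n 0 0) atTop (𝓝 0) := by
  induction hs : K + L generalizing K L with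
  | zero =>
    obtain ⟨rfl, rfl⟩ : K = 0 ∧ L = 0 := by omega
    simp
  | succ s ih =>
    rcases K with _ | K
    · have : (L : ℝ) < 1 := by push_cast at h2; linarith
      have : L < 1 := by exact_mod_cast this
      omega
    · have hx := hne (K + 1) L (by omega) le_rfl
      push_cast at h1 h2 hx
      rcases lt_or_gt_of_ne hx with h | h
      · rcases L with _ | L
        · have : (0 : ℝ) ≤ (K + 1) * b := by positivity
          simp at h
          linarith
        · push_cast at h1 h2 h
          have := ih (K + 1) L (by push_cast; linarith) (by push_cast; linarith) hne (by omega)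
          simpa using (hL (K + 1) L (by push_cast; linarith) (by push_cast; linarith)).add this
      · have := ih K L (by linarith) h (fun m c hm hmK => hne m c hm (by omega)) (by omega)
        simpa using (hK K L h h1).add this

/-- The alternating Birkhoff sum of `logTan` along the rotation by `b`. -/
noncomputable def altSum (b : ℝ) (K : ℕ) : ℝ :=
  ∑ m ∈ range K, (-1) ^ (m + 1) * logTan ((m + 1) * b)

theorem tendsto_reciprocity {b : ℝ} (hb : 0 < b) (hb1 : b ≤ 1) (K L : ℕ)
    (h1 : K * b < L + 1) (h2 : L < (K + 1) * b)
    (hne : ∀ m c : ℕ, 1 ≤ m → m ≤ K → m * b ≠ c) :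
    Tendsto (fun n => altSum b K - altSum (1 / b) L
      + (-1) ^ (K + L) * doubleSine b n (L + 1 - K * b) - doubleSine b n 1) atTop (𝓝 0) := by
  have := tendsto_of_staircase hb hb1 (fun n K L => altSum b K - altSum (1 / b) L
      + (-1) ^ (K + L) * doubleSine b n (L + 1 - K * b)) ?_ ?_ K L h1 h2 hne
  · simpa [altSum] using this
  · intro K L h h'
    have ht := tendsto_doubleSine_add_period hb (t := L + 1 - (K + 1) * b)
      (by linarith) (by linarith)
    have e : logTan (L + 1 - (K + 1) * b) = (-1) ^ (L + 1) * logTan ((K + 1) * b) := by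
      rw [← logTan_nat_sub]; push_cast; rfl
    have := (ht.const_mul ((-1) ^ (K + L + 1))).add_const ((-1) ^ (K + 1) * logTan ((K + 1) * b))
    rw [e] at this
    convert this using 2 with n
    · rw [altSum, sum_range_succ, ← altSum,
        show (L + 1 - (K + 1) * b + b : ℝ) = L + 1 - K * b by ring]
      push_cast
      ring
    · have : (-1 : ℝ) ^ (L * 2) = 1 := Even.neg_one_pow (by simp)
      ring_nf
      rw [this]
      ring
  · intro K L h h'
    have ht := tendsto_doubleSine_add_one hb (t := L + 1 - K * b)
      (by linarith) (by linarith)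
    have e : logTan ((L + 1 - K * b) / b) = (-1) ^ K * logTan ((L + 1) * (1 / b)) := by
      rw [← logTan_neg, ← logTan_nat_sub]; congr 1; field_simp; ring
    have := (ht.const_mul ((-1) ^ (K + L + 1))).sub_const
      ((-1) ^ (L + 1) * logTan ((L + 1) * (1 / b)))
    rw [e] at this
    convert this using 2 with n
    · rw [altSum, altSum, altSum, sum_range_succ,
        show (L + 1 - K * b + 1 : ℝ) = (L + 1 : ℕ) + 1 - K * b by push_cast; ring]
      push_cast
      ring
    · have : (-1 : ℝ) ^ (K * 2) = 1 := Even.neg_one_pow (by simp)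
      ring_nf
      rw [this]
      ring

/-- Among the admissible `L`, rounding keeps both arguments of the double sine away from `0`. -/
theorem exists_staircase_point {b : ℝ} (hb : 0 < b) (K : ℕ) :
    ∃ L : ℕ, b / 2 ≤ L + 1 - K * b ∧ b / 2 ≤ 1 + b - (L + 1 - K * b) := by
  refine ⟨⌊K * b + b / 2⌋₊, ?_, ?_⟩
  · have := Nat.lt_floor_add_one (K * b + b / 2); linarith
  · have := Nat.floor_le (show 0 ≤ K * b + b / 2 by positivity); linarith

/-- The reciprocity `b ↦ 1 / b` for `altSum`, up to two values of the double sine: one at a point at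
distance at least `b / 2` from the ends of `(0, 1 + b)`, and one at `1`. -/
theorem abs_altSum_le {b : ℝ} (hb : 0 < b) (hb2 : b ≤ 1 / 2) (K : ℕ)
    (hne : ∀ m c : ℕ, 1 ≤ m → m ≤ K → m * b ≠ c) :
    ∃ L : ℕ, L < (K + 1) * b ∧
      |altSum b K| ≤ |altSum (1 / b) L| + Real.log (1 / b) + Real.log 15 / 2 := by
  obtain ⟨L, hL1, hL2⟩ := exists_staircase_point hb K
  refine ⟨L, by linarith, ?_⟩
  have key := tendsto_reciprocity hb (by linarith) K L (by linarith) (by linarith) hne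
  set t : ℝ := L + 1 - K * b
  have hg : -altLog b (b / 2) ≤ Real.log (6 / b) / 2 := by
    have := le_altLog hb (half_pos hb)
    have e : Real.log (6 / b) / 2 = Real.log (b / 2 + b) / 2 - Real.log (b / 2) := by
      rw [show b / 2 + b = (b / 2) ^ 2 * (6 / b) by field_simp; ring,
        Real.log_mul (by positivity) (by positivity), Real.log_pow]
      push_cast
      ring
    linarith
  have hg2 : altLog b (1 + b / 2) ≤ Real.log (5 / 4) / 2 :=
    (altLog_le hb (by linarith)).trans
      (by gcongr; linarith)
  have hS : ∀ n, |doubleSine b n t| ≤ Real.log (6 / b) / 2 + Real.log (5 / 4) / 2 := by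
    intro n
    refine (abs_doubleSine_le hb (by linarith) (by linarith) n).trans ?_
    have m1 := altLog_mono hb (half_pos hb) hL1
    have m2 := altLog_mono hb (half_pos hb) hL2
    have m3 := altLog_mono hb (by linarith) (show t ≤ 1 + b / 2 by linarith)
    have m4 := altLog_mono hb (by linarith) (show 1 + b - t ≤ 1 + b / 2 by linarith)
    rw [abs_le]
    constructor <;> linarith
  have hS1 : ∀ n, |doubleSine b n 1| ≤ Real.log (2 / b) / 2 := by
    intro n
    refine (abs_doubleSine_le hb one_pos (by linarith) n).trans ?_
    rw [show 1 + b - 1 = b by ring]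
    have m1 := altLog_mono hb hb (show b ≤ 1 by linarith)
    have m2 := altLog_le hb one_pos
    have m3 := le_altLog hb hb
    have e : Real.log (2 / b) / 2 = Real.log (b + b) / 2 - Real.log b := by
      rw [show b + b = b ^ 2 * (2 / b) by field_simp; ring,
        Real.log_mul (by positivity) (by positivity), Real.log_pow]
      push_cast
      ring
    rw [Real.log_one] at m2
    rw [abs_of_nonneg (by linarith)]
    linarith
  have hsum : Real.log (6 / b) / 2 + Real.log (5 / 4) / 2 + Real.log (2 / b) / 2
      = Real.log (1 / b) + Real.log 15 / 2 := by
    rw [show 6 / b = 6 * (1 / b) by ring, show 2 / b = 2 * (1 / b) by ring,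
      Real.log_mul (by norm_num) (by positivity), Real.log_mul (by norm_num) (by positivity),
      show (15 : ℝ) = 6 * (5 / 4) * 2 by norm_num, Real.log_mul (by norm_num) (by norm_num),
      Real.log_mul (by norm_num) (by norm_num)]
    ring
  have hlim : |altSum b K - altSum (1 / b) L| ≤ Real.log (1 / b) + Real.log 15 / 2 := by
    have := ((key.const_sub (altSum b K - altSum (1 / b) L)).abs)
    rw [sub_zero] at this
    refine le_of_tendsto' this fun n => ?_
    rw [← hsum]
    have a1 : |(-1) ^ (K + L) * doubleSine b n t| = |doubleSine b n t| := by simp [abs_mul]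
    calc _ = |doubleSine b n 1 - (-1) ^ (K + L) * doubleSine b n t| := by congr 1; ring
      _ ≤ |doubleSine b n 1| + |(-1) ^ (K + L) * doubleSine b n t| := abs_sub _ _
      _ ≤ _ := by rw [a1]; linarith [hS n, hS1 n]
  have := abs_sub_abs_le_abs_sub (altSum b K) (altSum (1 / b) L)
  linarith

/-! ### The first renormalization step -/

/-- Partial sums of the analogue of the double sine function for the character `(-1)^m` of `ℤ²`,
normalized to vanish at `t = 1`. -/
noncomputable def sineCocycle (a : ℝ) (n : ℕ) (t : ℝ) : ℝ :=
  ∑ j ∈ range (n + 1), (altLog a (t + j) + altLog a (1 + a - t + j)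
    - altLog a (1 + j) - altLog a (a + j))

/-- The constant in the functional equation of `sineCocycle`. -/
noncomputable def sineConst (a : ℝ) (n : ℕ) : ℝ :=
  Real.log n + 2 * Real.log (n.factorial) - Real.log Real.pi
    - 2 * ∑ j ∈ range (n + 1), (altLog a (1 + j) + altLog a (a + j))

theorem neg_le_sineCocycle {a t : ℝ} (ha : 0 < a) (h1 : a / 2 ≤ t)
    (h2 : a / 2 ≤ 1 + a - t) (n : ℕ) : -(Real.log 6 / 2) ≤ sineCocycle a n t := by
  have hlog : 0 ≤ Real.log 6 := Real.log_nonneg (by norm_num)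
  -- If one argument `s` is below `a`, compare each term with the next one: the sum telescopes.
  have outer : ∀ s : ℝ, a / 2 ≤ s → s ≤ a → -(Real.log 6 / 2) ≤ sineCocycle a n s := by
    intro s hs hsa
    have step : ∀ j : ℕ, (altLog a (s + j) - altLog a (a + j))
        - (altLog a (s + (j + 1 : ℕ)) - altLog a (a + (j + 1 : ℕ))) ≤
        altLog a (s + j) + altLog a (1 + a - s + j) - altLog a (1 + j) - altLog a (a + j) := by
      intro j
      have hj : (0 : ℝ) ≤ j := j.cast_nonneg
      have := altLog_increment_le ha (show 0 < 1 + (j : ℝ) by linarith)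
        (show 1 + (j : ℝ) ≤ s + (j + 1 : ℕ) by push_cast; linarith) (sub_nonneg.2 hsa)
      rw [show 1 + (j : ℝ) + (a - s) = 1 + a - s + j by ring,
        show s + (j + 1 : ℕ) + (a - s) = a + (j + 1 : ℕ) by ring] at this
      linarith
    have tel := sum_le_sum fun j (_ : j ∈ range (n + 1)) => step j
    rw [sum_range_sub' fun j : ℕ => altLog a (s + j) - altLog a (a + j)] at tel
    have hn : (0 : ℝ) ≤ (n + 1 : ℕ) := Nat.cast_nonneg _
    have m1 := altLog_mono ha (show 0 < s + (n + 1 : ℕ) by linarith)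
      (show s + (n + 1 : ℕ) ≤ a + (n + 1 : ℕ) by linarith)
    have m2 := altLog_mono ha (half_pos ha) hs
    have m3 := altLog_le ha ha
    have m4 := le_altLog ha (half_pos ha)
    have e : Real.log (a / 2) - Real.log (a / 2 + a) / 2 = Real.log a / 2 - Real.log 6 / 2 := by
      rw [show a / 2 + a = (a / 2) ^ 2 * (6 / a) by field_simp; ring,
        Real.log_mul (by positivity) (by positivity), Real.log_pow,
        Real.log_div (by norm_num : (6 : ℝ) ≠ 0) ha.ne']
      push_cast
      ring
    simp only [Nat.cast_zero, add_zero] at tel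
    rw [sineCocycle]
    linarith
  rcases le_total t a with h | h
  · exact outer t h1 h
  rcases le_total (1 + a - t) a with h' | h'
  · have : sineCocycle a n t = sineCocycle a n (1 + a - t) := by
      unfold sineCocycle
      refine sum_congr rfl fun j _ => ?_
      rw [show 1 + a - (1 + a - t) = t by ring]
      ring
    rw [this]
    exact outer _ h2 h'
  · refine (neg_nonpos.2 (by positivity)).trans (sum_nonneg fun j _ => ?_)
    have hj : (0 : ℝ) ≤ j := j.cast_nonneg
    have := altLog_increment_le ha (show 0 < a + j by linarith)
      (show a + j ≤ 1 + a - t + j by linarith) (sub_nonneg.2 h)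
    rw [show 1 + a - t + j + (t - a) = 1 + j by ring, show a + j + (t - a) = t + j by ring] at this
    linarith

theorem tendsto_sineCocycle_add_period {a t : ℝ} (ha : 0 < a) (ht : 0 < t) (ht' : t < 1) :
    Tendsto (fun n => sineCocycle a n t + sineCocycle a n (t + a) - sineConst a n) atTop
      (𝓝 (Real.log (Real.sin (Real.pi * t)))) := by
  have h1 := Real.BohrMollerup.tendsto_log_gamma ht
  have h2 := Real.BohrMollerup.tendsto_log_gamma (sub_pos.2 ht')
  have r := congrArg Real.log (Real.Gamma_mul_Gamma_one_sub t)
  have hs : 0 < Real.sin (Real.pi * t) :=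
    Real.sin_pos_of_pos_of_lt_pi (by positivity) (by nlinarith [Real.pi_pos])
  rw [Real.log_mul (Real.Gamma_pos_of_pos ht).ne' (Real.Gamma_pos_of_pos (sub_pos.2 ht')).ne',
    Real.log_div Real.pi_ne_zero hs.ne'] at r
  rw [show Real.log (Real.sin (Real.pi * t)) = Real.log Real.pi
    - (Real.log (Real.Gamma t) + Real.log (Real.Gamma (1 - t))) by linarith]
  refine ((h1.add h2).const_sub (Real.log Real.pi)).congr fun n => ?_
  have : sineCocycle a n t + sineCocycle a n (t + a)
      = ∑ j ∈ range (n + 1), (Real.log (t + j) + Real.log (1 - t + j)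
        - 2 * (altLog a (1 + j) + altLog a (a + j))) := by
    rw [sineCocycle, sineCocycle, ← sum_add_distrib]
    refine sum_congr rfl fun j _ => ?_
    have hj : (0 : ℝ) ≤ j := j.cast_nonneg
    have e1 := altLog_add ha (show 0 < t + j by linarith)
    have e2 := altLog_add ha (show 0 < 1 - t + j by linarith)
    rw [show 1 + a - t + (j : ℝ) = 1 - t + j + a by ring,
      show 1 + a - (t + a) + (j : ℝ) = 1 - t + j by ring, show t + a + j = t + j + a by ring]
    linarith
  rw [this, sum_sub_distrib, sum_add_distrib, ← mul_sum]
  simp only [Real.BohrMollerup.logGammaSeq, sineConst]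
  ring

theorem tendsto_sineCocycle_add_one {a t : ℝ} (ha : 0 < a) (ht : 0 < t) (ht' : t < a) :
    Tendsto (fun n => sineCocycle a n (t + 1) - sineCocycle a n t) atTop
      (𝓝 (-logTan (t / a))) := by
  have h := (tendsto_add_atTop_iff_nat 1).2 (tendsto_altLog_sub ha (sub_pos.2 ht') ht)
  have h0 := altLog_reflect ha ht ht'
  rw [logTan, show Real.pi * (t / a) / 2 = Real.pi * t / (2 * a) by field_simp, ← h0]
  have h3 := h.sub_const (altLog a t - altLog a (a - t))
  rw [zero_sub] at h3
  refine h3.congr fun n => ?_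
  have tel := sum_range_sub (fun j : ℕ => altLog a (t + j) - altLog a (a - t + j)) (n + 1)
  simp only [Nat.cast_zero, add_zero] at tel
  rw [← tel, sineCocycle, sineCocycle, ← sum_sub_distrib]
  refine sum_congr rfl fun j _ => ?_
  push_cast
  rw [show 1 + a - t + (j : ℝ) = a - t + (j + 1) by ring,
    show 1 + a - (t + 1) + (j : ℝ) = a - t + j by ring, show t + 1 + (j : ℝ) = t + (j + 1) by ring]
  ring

theorem log_sin_nat_sub (x : ℝ) (n : ℕ) :
    Real.log (Real.sin (Real.pi * (n - x))) = Real.log (Real.sin (Real.pi * x)) := by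
  rw [← Real.log_abs, ← Real.log_abs (Real.sin (Real.pi * x))]
  congr 1
  rw [mul_sub, mul_comm, Real.sin_sub]
  simp [abs_mul, Real.cos_nat_mul_pi]

/-- The alternating Birkhoff sum of `log |sin π x|` along the rotation by `a`. -/
noncomputable def sineSum (a : ℝ) (K : ℕ) : ℝ :=
  ∑ m ∈ range K, (-1) ^ (m + 1) * Real.log (Real.sin (Real.pi * ((m + 1) * a)))

theorem tendsto_sine_reciprocity {a : ℝ} (ha : 0 < a) (ha1 : a ≤ 1) (K L : ℕ)
    (h1 : K * a < L + 1) (h2 : L < (K + 1) * a)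
    (hne : ∀ m c : ℕ, 1 ≤ m → m ≤ K → m * a ≠ c) :
    Tendsto (fun n => sineSum a K + (∑ m ∈ range K, (-1) ^ (m + 1)) * sineConst a n
      - (-1) ^ K * sineCocycle a n (L + 1 - K * a)
      - ∑ c ∈ range L, logTan ((c + 1) / a)) atTop (𝓝 0) := by
  have := tendsto_of_staircase ha ha1 (fun n K L => sineSum a K
      + (∑ m ∈ range K, (-1) ^ (m + 1)) * sineConst a n
      - (-1) ^ K * sineCocycle a n (L + 1 - K * a)
      - ∑ c ∈ range L, logTan ((c + 1) / a)) ?_ ?_ K L h1 h2 hne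
  · have h0 : ∀ n, sineCocycle a n 1 = 0 := fun n =>
      sum_eq_zero fun j _ => by rw [show 1 + a - 1 = a by ring]; ring
    simpa [sineSum, h0] using this
  · intro K L h h'
    have ht := tendsto_sineCocycle_add_period ha (t := (L + 1 : ℕ) - (K + 1) * a)
      (by push_cast; linarith) (by push_cast; linarith)
    rw [log_sin_nat_sub] at ht
    have := (ht.const_mul ((-1) ^ K)).add_const
      ((-1) ^ (K + 1) * Real.log (Real.sin (Real.pi * ((K + 1) * a))))
    convert this using 2 with n
    · rw [sineSum, sineSum, sum_range_succ, sum_range_succ,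
        show ((L + 1 : ℕ) - (K + 1) * a + a : ℝ) = L + 1 - K * a by push_cast; ring]
      push_cast
      ring
    · ring
  · intro K L h h'
    have ht := tendsto_sineCocycle_add_one ha (t := L + 1 - K * a)
      (by linarith) (by linarith)
    have e : logTan ((L + 1 - K * a) / a) = (-1) ^ K * logTan ((L + 1) / a) := by
      rw [← logTan_neg, ← logTan_nat_sub]; congr 1; field_simp; ring
    rw [e] at ht
    have := (ht.const_mul (-(-1) ^ K)).sub_const (logTan ((L + 1) / a))
    convert this using 2 with n
    · rw [sum_range_succ,
        show (L + 1 - K * a + 1 : ℝ) = (L + 1 : ℕ) + 1 - K * a by push_cast; ring]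
      push_cast
      ring
    · have : (-1 : ℝ) ^ (K * 2) = 1 := Even.neg_one_pow (by simp)
      ring_nf
      rw [this]
      ring

/-- For even `K` the constants `sineConst` cancel, so that only the lower bound of `sineCocycle`
matters. -/
theorem neg_sineSum_le {a : ℝ} (ha : 0 < a) (ha1 : a ≤ 1) (K : ℕ) (hK : Even K)
    (hne : ∀ m c : ℕ, 1 ≤ m → m ≤ K → m * a ≠ c) :
    ∃ L : ℕ, L < (K + 1) * a ∧
      -sineSum a K ≤ -∑ c ∈ range L, logTan ((c + 1) / a) + Real.log 6 / 2 := by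
  obtain ⟨L, hL1, hL2⟩ := exists_staircase_point ha K
  refine ⟨L, by linarith, ?_⟩
  have key := tendsto_sine_reciprocity ha ha1 K L (by linarith) (by linarith) hne
  have h0 : ∀ k, ∑ m ∈ range (k + k), (-1 : ℝ) ^ (m + 1) = 0 := by
    intro k
    induction k with
    | zero => simp
    | succ k ih =>
      rw [show k + 1 + (k + 1) = k + k + 1 + 1 by ring, sum_range_succ, sum_range_succ, ih]
      ring
  have h1 : ∑ m ∈ range K, (-1 : ℝ) ^ (m + 1) = 0 := by
    obtain ⟨k, rfl⟩ := hK
    exact h0 k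
  rw [h1, hK.neg_one_pow] at key
  have := le_of_tendsto' key
    (b := sineSum a K + Real.log 6 / 2 - ∑ c ∈ range L, logTan ((c + 1) / a)) fun n => ?_
  · linarith
  · have := neg_le_sineCocycle ha hL1 hL2 n
    linarith

/-! ### Continued fractions -/

theorem cfrac_nonneg (a : ℕ → ℕ) (n : ℕ) : 0 ≤ cfrac a n := by
  induction n generalizing a with
  | zero => exact le_rfl
  | succ n ih =>
    have := ih fun k => a (k + 1)
    rw [cfrac]
    positivity

theorem one_div_add_num_den {k : ℕ} (hk : 0 < k) {x : ℚ} (hx : 0 ≤ x) :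
    (1 / (k + x)).num = x.den ∧ ((1 / (k + x)).den : ℤ) = k * x.den + x.num := by
  have hn : 0 ≤ x.num := Rat.num_nonneg.2 hx
  have hd : (0 : ℤ) < x.den := by exact_mod_cast x.den_pos
  have hk' : (0 : ℤ) < k := by exact_mod_cast hk
  have hpos : 0 < k * (x.den : ℤ) + x.num := by positivity
  have hco : Nat.Coprime (x.den : ℤ).natAbs (k * (x.den : ℤ) + x.num).natAbs := by
    rw [← Int.isCoprime_iff_nat_coprime]
    have : IsCoprime (x.den : ℤ) x.num :=
      (Int.isCoprime_iff_nat_coprime.2 (by simpa using x.reduced)).symm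
    rw [add_comm]
    exact this.add_mul_right_right _
  have e : 1 / ((k : ℚ) + x) = ((x.den : ℤ) : ℚ) / ((k * (x.den : ℤ) + x.num : ℤ) : ℚ) := by
    have h0 : (x.den : ℚ) ≠ 0 := by exact_mod_cast x.den_ne_zero
    have h1 : (k : ℚ) + x ≠ 0 := by
      have : (0 : ℚ) < k := by exact_mod_cast hk
      positivity
    have h2 : ((k * (x.den : ℤ) + x.num : ℤ) : ℚ) ≠ 0 := by exact_mod_cast hpos.ne'
    rw [div_eq_div_iff h1 h2]
    push_cast
    have := Rat.mul_den_eq_num x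
    linear_combination -this
  rw [e]
  exact ⟨Rat.num_div_eq_of_coprime hpos hco, Rat.den_div_eq_of_coprime hpos hco⟩

theorem cfrac_succ_num (a : ℕ → ℕ) (n : ℕ) (h : 0 < a 1) :
    (cfrac a (n + 1)).num = (cfrac (fun k => a (k + 1)) n).den :=
  (one_div_add_num_den h (cfrac_nonneg _ _)).1

theorem mul_den_le_cfrac_succ_den (a : ℕ → ℕ) (n : ℕ) (h : 0 < a 1) :
    a 1 * (cfrac (fun k => a (k + 1)) n).den ≤ (cfrac a (n + 1)).den := by
  have h1 : ((cfrac a (n + 1)).den : ℤ) = _ :=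
    (one_div_add_num_den h (cfrac_nonneg (fun k => a (k + 1)) n)).2
  have h2 := Rat.num_nonneg.2 (cfrac_nonneg (fun k => a (k + 1)) n)
  zify
  linarith

theorem two_pow_le_den_of_even (a : ℕ → ℕ) (n : ℕ)
    (h : ∀ k, 1 ≤ k → k ≤ n → 0 < a k ∧ Even (a k)) : 2 ^ n ≤ (cfrac a n).den := by
  induction n generalizing a with
  | zero => exact (cfrac a 0).den_pos
  | succ n ih =>
    have h1 := h 1 le_rfl (by omega)
    have h2 : 2 ≤ a 1 := by obtain ⟨h, c, hc⟩ := h1; omega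
    calc 2 ^ (n + 1) = 2 * 2 ^ n := by ring
      _ ≤ a 1 * (cfrac (fun k => a (k + 1)) n).den :=
        Nat.mul_le_mul h2 (ih _ fun k hk hkn => h (k + 1) (by omega) (by omega))
      _ ≤ _ := mul_den_le_cfrac_succ_den a n h1.1

theorem two_pow_le_den (a : ℕ → ℕ) (n : ℕ) (h0 : 0 < a 1)
    (h : ∀ k, 2 ≤ k → k ≤ n + 1 → 0 < a k ∧ Even (a k)) : 2 ^ n ≤ (cfrac a (n + 1)).den :=
  (two_pow_le_den_of_even (fun k => a (k + 1)) n
    fun k hk hkn => h (k + 1) (by omega) (by omega)).trans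
    ((Nat.le_mul_of_pos_left _ h0).trans (mul_den_le_cfrac_succ_den a n h0))

theorem mul_ne_of_lt_den {x : ℚ} {m : ℕ} (c : ℕ) (hm : 1 ≤ m) (hmx : m < x.den) :
    (m : ℝ) * x ≠ c := by
  intro h
  have h1 : (m : ℚ) * x = c := by exact_mod_cast h
  have h2 : (m : ℚ) * x.num = c * x.den := by
    rw [← h1, mul_assoc, Rat.mul_den_eq_num]
  have h3 : (m : ℤ) * x.num = c * x.den := by exact_mod_cast h2
  have h4 : (x.den : ℤ) ∣ m * x.num := ⟨c, by rw [h3, mul_comm]⟩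
  have h5 : IsCoprime (x.den : ℤ) x.num :=
    (Int.isCoprime_iff_nat_coprime.2 (by simpa using x.reduced)).symm
  have h6 := Int.le_of_dvd (by omega) (h5.dvd_of_dvd_mul_right h4)
  omega

theorem altSum_natCast_add {k : ℕ} (hk : Even k) (x : ℝ) (L : ℕ) :
    altSum (k + x) L = altSum x L := by
  refine sum_congr rfl fun m _ => ?_
  have := logTan_add_nat ((m + 1) * x) ((m + 1) * k)
  rw [Even.neg_one_pow (hk.mul_left _), one_mul] at this
  rw [← this]
  push_cast
  congr 2
  ring

/-- Reciprocity and periodicity reduce `altSum` along `[a₁, …, aₙ]`, all `aₖ` even, to `altSum`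
along `[a₂, …, aₙ]`; the losses `log (1 / β)` add up to the logarithm of the denominator. -/
theorem abs_altSum_cfrac_le (a : ℕ → ℕ) (n : ℕ)
    (h : ∀ k, 1 ≤ k → k ≤ n → 0 < a k ∧ Even (a k)) (K : ℕ) (hK : K < (cfrac a n).den) :
    |altSum (cfrac a n : ℚ) K| ≤ Real.log (cfrac a n).den + n * (Real.log 15 / 2) := by
  induction n generalizing a K with
  | zero =>
    have : K = 0 := by simpa [cfrac] using hK
    subst this
    simp [altSum, cfrac]
  | succ n ih =>
    obtain ⟨h0, h1⟩ := h 1 le_rfl (by omega)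
    have h2 : 2 ≤ a 1 := by obtain ⟨c, hc⟩ := h1; omega
    have hb : ((cfrac a (n + 1) : ℚ) : ℝ) = 1 / (a 1 + (cfrac (fun k => a (k + 1)) n : ℚ)) := by
      rw [cfrac]; push_cast; rfl
    have hnum := cfrac_succ_num a n h0
    set x := cfrac (fun k => a (k + 1)) n with hx
    set b := cfrac a (n + 1) with hbdef
    have hx0 : (0 : ℝ) ≤ x := by exact_mod_cast cfrac_nonneg _ _
    have h2' : (2 : ℝ) ≤ a 1 := by exact_mod_cast h2
    have hb0 : (0 : ℝ) < b := by rw [hb]; positivity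
    have hb2 : (b : ℝ) ≤ 1 / 2 := by
      rw [hb]
      exact one_div_le_one_div_of_le two_pos (by linarith)
    obtain ⟨L, hL, hKL⟩ := abs_altSum_le hb0 hb2 K fun m c hm hmK =>
      mul_ne_of_lt_den c hm (by omega)
    have hbd : (b.den : ℝ) * b = x.den := by
      have : (b * b.den : ℚ) = x.den := by rw [Rat.mul_den_eq_num, hnum]; simp
      rw [mul_comm]
      exact_mod_cast this
    have hLx : L < x.den := by
      have : (K + 1 : ℝ) ≤ b.den := by exact_mod_cast hK
      have : (L : ℝ) < x.den := by rw [← hbd]; nlinarith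
      exact_mod_cast this
    have e1 : 1 / (b : ℝ) = a 1 + (x : ℚ) := by rw [hb, one_div_one_div]
    have e2 : Real.log (1 / b) = Real.log b.den - Real.log x.den := by
      have : (b.den : ℝ) ≠ 0 := by exact_mod_cast b.den_ne_zero
      rw [← hbd, Real.log_mul this hb0.ne', one_div, Real.log_inv]
      ring
    have := ih (fun k => a (k + 1)) (fun k hk hkn => h (k + 1) (by omega) (by omega)) L hLx
    rw [e2, e1, altSum_natCast_add h1] at hKL
    push_cast
    linarith

/-- The bound for the alternating sums of `log |sin π j α|`, `α = [a₁, …, aₙ]`. -/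
theorem neg_sineSum_cfrac_le (a : ℕ → ℕ) (n : ℕ) (h0 : Odd (a 1))
    (h : ∀ k, 2 ≤ k → k ≤ n + 1 → 0 < a k ∧ Even (a k)) (K : ℕ) (hK : K < (cfrac a (n + 1)).den)
    (hKe : Even K) :
    -sineSum (cfrac a (n + 1) : ℚ) K ≤
      Real.log (cfrac a (n + 1)).den + n * (Real.log 15 / 2) + Real.log 6 / 2 := by
  have ha : 0 < a 1 := h0.pos
  have hb : ((cfrac a (n + 1) : ℚ) : ℝ) = 1 / (a 1 + (cfrac (fun k => a (k + 1)) n : ℚ)) := by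
    rw [cfrac]; push_cast; rfl
  have hnum := cfrac_succ_num a n ha
  have hden := mul_den_le_cfrac_succ_den a n ha
  have IH := abs_altSum_cfrac_le (fun k => a (k + 1)) n
    fun k hk hkn => h (k + 1) (by omega) (by omega)
  set x := cfrac (fun k => a (k + 1)) n with hx
  set b := cfrac a (n + 1) with hbdef
  have hx0 : (0 : ℝ) ≤ x := by exact_mod_cast cfrac_nonneg _ _
  have h1' : (1 : ℝ) ≤ a 1 := by exact_mod_cast ha
  have hb0 : (0 : ℝ) < b := by rw [hb]; positivity
  have hb1 : (b : ℝ) ≤ 1 := by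
    rw [hb]
    exact div_le_one_of_le₀ (by linarith) (by linarith)
  obtain ⟨L, hL, hKL⟩ := neg_sineSum_le hb0 hb1 K hKe fun m c hm hmK =>
    mul_ne_of_lt_den c hm (by omega)
  have hbd : (b.den : ℝ) * b = x.den := by
    have : (b * b.den : ℚ) = x.den := by rw [Rat.mul_den_eq_num, hnum]; simp
    rw [mul_comm]
    exact_mod_cast this
  have hLx : L < x.den := by
    have : (K + 1 : ℝ) ≤ b.den := by exact_mod_cast hK
    have : (L : ℝ) < x.den := by rw [← hbd]; nlinarith
    exact_mod_cast this
  have e1 : 1 / (b : ℝ) = a 1 + (x : ℚ) := by rw [hb, one_div_one_div]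
  have e2 : ∑ c ∈ range L, logTan ((c + 1) / b) = altSum x L := by
    refine sum_congr rfl fun c _ => ?_
    have := logTan_add_nat ((c + 1) * x) ((c + 1) * a 1)
    rw [mul_comm (c + 1), pow_mul, h0.neg_one_pow] at this
    rw [← this, div_eq_mul_one_div, e1]
    push_cast
    congr 1
    ring
  have hxb : Real.log x.den ≤ Real.log b.den := by
    have : 0 < x.den := x.den_pos
    refine Real.log_le_log (by exact_mod_cast this) ?_
    exact_mod_cast (Nat.le_mul_of_pos_left _ ha).trans hden
  have := IH L hLx
  have := neg_le_abs (altSum x L)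
  rw [e2] at hKL
  linarith

/-- If `q_{k+1} ≥ q_k^ν`, the denominator gains a factor of at least `15` at every level with
`q_k ^ (ν - 1) ≥ 15`, hence at all levels beyond one that depends on `ν` only. -/
theorem exists_pow_le_mul_den {ν : ℝ} (hν : 1 < ν) : ∃ C : ℝ, 0 < C ∧ ∀ (a : ℕ → ℕ) (n : ℕ),
    Odd (a 1) → (∀ k, 2 ≤ k → k ≤ n + 1 → 0 < a k ∧ Even (a k)) →
    (∀ k, 1 ≤ k → k + 1 ≤ n + 1 → (convDen a k : ℝ) ^ ν ≤ (convDen a (k + 1) : ℝ)) →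
    (15 : ℝ) ^ n ≤ C * (cfrac a (n + 1)).den := by
  obtain ⟨m, hm⟩ := pow_unbounded_of_one_lt ((15 : ℝ) ^ (1 / (ν - 1))) one_lt_two
  refine ⟨15 ^ m, by positivity, fun a n h0 h hq => ?_⟩
  suffices ∀ k ≤ n, (15 : ℝ) ^ k ≤ 15 ^ m * (cfrac a (k + 1)).den from this n le_rfl
  intro k
  induction k with
  | zero =>
    intro _
    have : 0 < (cfrac a (0 + 1)).den := Rat.den_pos _
    have h1 : (1 : ℝ) ≤ (cfrac a (0 + 1)).den := by exact_mod_cast this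
    have h2 : (1 : ℝ) ≤ 15 ^ m := one_le_pow₀ (by norm_num)
    rw [pow_zero]
    nlinarith
  | succ k ih =>
    intro hk
    have hd : (2 : ℝ) ^ k ≤ (cfrac a (k + 1)).den := by
      exact_mod_cast two_pow_le_den a k h0.pos fun j hj hjk => h j hj (by omega)
    have hd' : 0 < (cfrac a (k + 1 + 1)).den := Rat.den_pos _
    rcases lt_or_ge k m with hkm | hkm
    · have h1 : (1 : ℝ) ≤ (cfrac a (k + 1 + 1)).den := by exact_mod_cast hd'
      have h2 : (15 : ℝ) ^ (k + 1) ≤ 15 ^ m := pow_le_pow_right₀ (by norm_num) hkm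
      nlinarith [pow_pos (show (0 : ℝ) < 15 by norm_num) m]
    · have hq' := hq (k + 1) (by omega) (by omega)
      rw [convDen, convDen] at hq'
      set d : ℝ := ((cfrac a (k + 1)).den : ℝ) with hdd
      have hA : (15 : ℝ) ^ (1 / (ν - 1)) ≤ d :=
        hm.le.trans ((pow_le_pow_right₀ one_le_two hkm).trans hd)
      have hd0 : 0 < d := lt_of_lt_of_le (by positivity) hA
      have h15 : 15 ≤ d ^ (ν - 1) := by
        calc (15 : ℝ) = (15 ^ (1 / (ν - 1))) ^ (ν - 1) := by
              rw [← Real.rpow_mul (by norm_num), one_div_mul_cancel (by linarith), Real.rpow_one]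
          _ ≤ d ^ (ν - 1) := Real.rpow_le_rpow (by positivity) hA (by linarith)
      have hdν : d ^ ν = d * d ^ (ν - 1) := by
        rw [← Real.rpow_one_add' hd0.le (by linarith)]
        congr 1
        ring
      have := ih (by omega)
      calc (15 : ℝ) ^ (k + 1) = 15 ^ k * 15 := pow_succ _ _
        _ ≤ (15 ^ m * d) * d ^ (ν - 1) := by gcongr
        _ = 15 ^ m * d ^ ν := by rw [hdν]; ring
        _ ≤ _ := by gcongr

/-! ### Products of hopping amplitudes -/

/-- The squared hopping amplitude `(2 sin π j α)²` of the chain unitarily equivalent to the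
operator at the frequency `α`. -/
noncomputable def bond (α : ℝ) (j : ℕ) : ℝ := (2 * Real.sin (Real.pi * (j * α))) ^ 2

/-- The product of the odd bonds up to `2 i - 1`. -/
noncomputable def oddProd (α : ℝ) (i : ℕ) : ℝ := ∏ l ∈ range i, bond α (2 * l + 1)

/-- The product of the even bonds up to `2 i`. -/
noncomputable def evenProd (α : ℝ) (i : ℕ) : ℝ := ∏ l ∈ range i, bond α (2 * l + 2)

theorem bond_pos {x : ℚ} {j : ℕ} (hj : 1 ≤ j) (hjx : j < x.den) : 0 < bond x j := by
  have : Real.sin (Real.pi * (j * x)) ≠ 0 := by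
    rw [Real.sin_ne_zero_iff]
    intro n hn
    rw [mul_comm] at hn
    have h1 : (n : ℝ) = j * x := mul_left_cancel₀ Real.pi_ne_zero (by linarith)
    rcases lt_trichotomy n 0 with h | rfl | h
    · have h2 : (j : ℝ) * (-x : ℚ) = (n.natAbs : ℕ) := by
        have : ((n.natAbs : ℤ) : ℝ) = -n := by rw [Int.natCast_natAbs, abs_of_neg h]; simp
        rw [← Int.cast_natCast (R := ℝ) n.natAbs, this, h1]
        push_cast
        ring
      exact mul_ne_of_lt_den n.natAbs hj (by simpa using hjx) h2
    · exact mul_ne_of_lt_den 0 hj hjx (by simpa using h1.symm)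
    · have h2 : (j : ℝ) * x = (n.natAbs : ℕ) := by
        have : ((n.natAbs : ℤ) : ℝ) = n := by rw [Int.natCast_natAbs, abs_of_pos h]
        rw [← Int.cast_natCast (R := ℝ) n.natAbs, this, h1]
      exact mul_ne_of_lt_den n.natAbs hj hjx h2
  unfold bond
  positivity

theorem oddProd_pos {x : ℚ} {i : ℕ} (hi : 2 * i < x.den + 1) : 0 < oddProd x i :=
  prod_pos fun l hl => bond_pos (by omega) (by have := mem_range.1 hl; omega)

theorem evenProd_pos {x : ℚ} {i : ℕ} (hi : 2 * i < x.den) : 0 < evenProd x i :=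
  prod_pos fun l hl => bond_pos (by omega) (by have := mem_range.1 hl; omega)

theorem log_bond {x : ℚ} {j : ℕ} (hj : 1 ≤ j) (hjx : j < x.den) :
    Real.log (bond x j) = 2 * (Real.log 2 + Real.log (Real.sin (Real.pi * (j * x)))) := by
  have h := bond_pos hj hjx
  have h0 : Real.sin (Real.pi * (j * x)) ≠ 0 := by
    intro h0
    simp [bond, h0] at h
  rw [bond, Real.log_pow, Real.log_mul two_ne_zero h0]
  norm_num

theorem log_oddProd_sub_log_evenProd {x : ℚ} {i : ℕ} (hi : 2 * i < x.den) :
    Real.log (oddProd x i) - Real.log (evenProd x i) = 2 * -sineSum x (2 * i) := by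
  induction i with
  | zero => simp [oddProd, evenProd, sineSum]
  | succ i ih =>
    have ih := ih (by omega)
    have h1 := log_bond (x := x) (j := 2 * i + 1) (by omega) (by omega)
    have h2 := log_bond (x := x) (j := 2 * i + 2) (by omega) (by omega)
    have e1 : oddProd x (i + 1) = oddProd x i * bond x (2 * i + 1) := prod_range_succ _ _
    have e2 : evenProd x (i + 1) = evenProd x i * bond x (2 * i + 2) := prod_range_succ _ _
    have e3 : sineSum x (2 * (i + 1)) = sineSum x (2 * i)
        - Real.log (Real.sin (Real.pi * ((2 * i + 1 : ℕ) * x)))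
        + Real.log (Real.sin (Real.pi * ((2 * i + 2 : ℕ) * x))) := by
      have p1 : (-1 : ℝ) ^ (2 * i + 1) = -1 := Odd.neg_one_pow ⟨i, rfl⟩
      have p2 : (-1 : ℝ) ^ (2 * i + 1 + 1) = 1 := Even.neg_one_pow ⟨i + 1, by ring⟩
      rw [show 2 * (i + 1) = 2 * i + 1 + 1 by ring, sineSum, sum_range_succ, sum_range_succ,
        ← sineSum, p1, p2]
      push_cast
      rw [show (2 * (i : ℝ) + 1 + 1) = 2 * i + 2 by ring]
      ring
    rw [e1, e2, e3, Real.log_mul (oddProd_pos (by omega)).ne' (bond_pos (by omega) (by omega)).ne',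
      Real.log_mul (evenProd_pos (by omega)).ne' (bond_pos (by omega) (by omega)).ne', h1, h2]
    linarith

/-- With `ζ = exp (4 π i α)`, a primitive root of unity of odd order `q`, the product is
`∏ |1 - ζ ^ l|` over `0 < l < q`. -/
theorem evenProd_eq {x : ℚ} (hx : 0 ≤ x) {h : ℕ} (hh : x.den = 2 * h + 1) :
    evenProd x h = x.den := by
  set ζ : ℂ := Complex.exp (2 * Real.pi * Complex.I * ((2 * x.num.natAbs : ℕ) / (x.den : ℕ)))
    with hζ
  have hx' : ((x.num.natAbs : ℕ) : ℝ) / (x.den : ℕ) = x := by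
    have h1 : ((x.num.natAbs : ℤ)) = x.num := Int.natAbs_of_nonneg (Rat.num_nonneg.2 hx)
    have h2 : ((x.num.natAbs : ℤ) : ℝ) = x.num := by rw [h1]
    rw [← Int.cast_natCast, h2]
    exact (Rat.cast_def x).symm
  have prim : IsPrimitiveRoot ζ (2 * h + 1) := by
    rw [← hh]
    refine Complex.isPrimitiveRoot_exp_of_coprime _ _ x.den_ne_zero
      (Nat.Coprime.mul_left ?_ x.reduced)
    rw [hh]
    exact (Nat.coprime_mul_left_add_right 2 1 h).2 (by norm_num)
  have hnorm : ∀ l : ℕ, ‖1 - ζ ^ l‖ ^ 2 = bond x (2 * l) := by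
    intro l
    have e : ζ ^ l = Complex.exp (Complex.I * (2 * (Real.pi * ((2 * l : ℕ) * x)) : ℝ)) := by
      rw [hζ, ← Complex.exp_nat_mul, ← hx']
      congr 1
      push_cast
      ring
    rw [e, norm_sub_rev, Complex.norm_exp_I_mul_ofReal_sub_one, bond,
      mul_div_cancel_left₀ _ two_ne_zero, Real.norm_eq_abs, sq_abs]
  have hrefl : ∀ l ∈ range h, ‖1 - ζ ^ (h + (h - 1 - l) + 1)‖ = ‖1 - ζ ^ (l + 1)‖ := by
    intro l hl
    have hl := mem_range.1 hl
    have e : ζ ^ (h + (h - 1 - l) + 1) * ζ ^ (l + 1) = 1 := by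
      rw [← pow_add, show h + (h - 1 - l) + 1 + (l + 1) = 2 * h + 1 by omega, prim.pow_eq_one]
    have n1 : ‖ζ ^ (l + 1)‖ = 1 := by rw [norm_pow, prim.norm'_eq_one (by omega), one_pow]
    calc ‖1 - ζ ^ (h + (h - 1 - l) + 1)‖
        = ‖1 - ζ ^ (h + (h - 1 - l) + 1)‖ * ‖ζ ^ (l + 1)‖ := by rw [n1, mul_one]
      _ = ‖ζ ^ (l + 1) - 1‖ := by rw [← norm_mul, sub_mul, e, one_mul]
      _ = _ := norm_sub_rev _ _
  have hprod := congrArg norm prim.prod_one_sub_pow_eq_order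
  rw [norm_prod, two_mul, prod_range_add,
    ← prod_range_reflect (fun l => ‖1 - ζ ^ (h + l + 1)‖), prod_congr rfl hrefl,
    ← prod_mul_distrib] at hprod
  calc evenProd x h = ∏ l ∈ range h, ‖1 - ζ ^ (l + 1)‖ * ‖1 - ζ ^ (l + 1)‖ :=
        prod_congr rfl fun l _ => by rw [← sq, hnorm, mul_add]
    _ = x.den := by
      rw [hprod, hh]
      have : ((h + h : ℕ) : ℂ) + 1 = ((2 * h + 1 : ℕ) : ℂ) := by push_cast; ring
      rw [this, Complex.norm_natCast]

/-- The bound on the slope of the discriminant at `0`. -/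
theorem sum_oddProd_le (a : ℕ → ℕ) (n : ℕ) (h0 : Odd (a 1))
    (ha : ∀ k, 2 ≤ k → k ≤ n + 1 → 0 < a k ∧ Even (a k)) (h : ℕ)
    (hh : (cfrac a (n + 1)).den = 2 * h + 1) :
    ∑ i ∈ range (h + 1), oddProd (cfrac a (n + 1) : ℚ) i *
      (evenProd (cfrac a (n + 1) : ℚ) h / evenProd (cfrac a (n + 1) : ℚ) i)
      ≤ 6 * 15 ^ n * ((cfrac a (n + 1)).den : ℝ) ^ 4 := by
  have key := neg_sineSum_cfrac_le a n h0 ha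
  have hx := cfrac_nonneg a (n + 1)
  set x := cfrac a (n + 1)
  have hd : (0 : ℝ) < x.den := by exact_mod_cast x.den_pos
  have hterm : ∀ i ∈ range (h + 1), oddProd x i * (evenProd x h / evenProd x i)
      ≤ 6 * 15 ^ n * (x.den : ℝ) ^ 3 := by
    intro i hi
    have hi := mem_range.1 hi
    have p1 := oddProd_pos (x := x) (i := i) (by omega)
    have p2 := evenProd_pos (x := x) (i := i) (by omega)
    have h1 := log_oddProd_sub_log_evenProd (x := x) (i := i) (by omega)
    have h2 := key (2 * i) (by omega) (even_two_mul i)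
    have h3 : oddProd x i / evenProd x i ≤ 6 * 15 ^ n * (x.den : ℝ) ^ 2 := by
      rw [← Real.log_le_log_iff (by positivity) (by positivity), Real.log_div p1.ne' p2.ne', h1,
        Real.log_mul (by positivity) (by positivity), Real.log_mul (by positivity) (by positivity),
        Real.log_pow, Real.log_pow]
      push_cast
      linarith
    rw [evenProd_eq hx hh]
    calc oddProd x i * (x.den / evenProd x i) = oddProd x i / evenProd x i * x.den := by ring
      _ ≤ 6 * 15 ^ n * (x.den : ℝ) ^ 2 * x.den := by gcongr
      _ = _ := by ring
  have hhd : ((h + 1 : ℕ) : ℝ) ≤ x.den := by exact_mod_cast (by omega : h + 1 ≤ x.den)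
  calc _ ≤ (range (h + 1)).card • (6 * 15 ^ n * (x.den : ℝ) ^ 3) := sum_le_card_nsmul _ _ _ hterm
    _ = ((h + 1 : ℕ) : ℝ) * (6 * 15 ^ n * (x.den : ℝ) ^ 3) := by rw [card_range, nsmul_eq_mul]
    _ ≤ x.den * (6 * 15 ^ n * (x.den : ℝ) ^ 3) := by gcongr
    _ = _ := by ring

/-! ### Monodromy and Bloch solutions -/

/-- The product of the first `k` transfer matrices for the potential `V` at the energy `E`,
over an arbitrary commutative ring. -/
def monodromy {R : Type*} [CommRing R] (V : ℕ → R) (E : R) (k : ℕ) : Matrix (Fin 2) (Fin 2) R :=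
  ((List.range k).map fun i => !![E - V (i + 1), -1; 1, 0]).prod

section Monodromy

variable {R : Type*} [CommRing R] (V : ℕ → R) (E : R)

theorem monodromy_succ (k : ℕ) :
    monodromy V E (k + 1) = monodromy V E k * !![E - V (k + 1), -1; 1, 0] := by
  simp [monodromy, List.range_succ]

theorem det_monodromy (k : ℕ) : (monodromy V E k).det = 1 := by
  induction k with
  | zero => simp [monodromy]
  | succ k ih => rw [monodromy_succ, Matrix.det_mul, ih, Matrix.det_fin_two]; simp

theorem map_monodromy {S : Type*} [CommRing S] (f : R →+* S) (k : ℕ) :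
    (monodromy V E k).map f = monodromy (fun j => f (V j)) (f E) k := by
  induction k with
  | zero => simp [monodromy]
  | succ k ih =>
    rw [monodromy_succ, Matrix.map_mul, ih, monodromy_succ]
    congr 1
    ext i j
    fin_cases i <;> fin_cases j <;> simp

theorem map_trace_monodromy {S : Type*} [CommRing S] (f : R →+* S) (k : ℕ) :
    f (monodromy V E k).trace = (monodromy (fun j => f (V j)) (f E) k).trace := by
  rw [← map_monodromy]
  simp [Matrix.trace_fin_two]

/-- Shifting the potential by one period step conjugates the monodromy matrix. -/
theorem trace_monodromy_shift {q : ℕ} (hV : V (q + 1) = V 1) :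
    (monodromy (fun j => V (j + 1)) E q).trace = (monodromy V E q).trace := by
  rcases q with _ | q
  · simp [monodromy]
  · have e : monodromy V E (q + 1)
        = !![E - V 1, -1; 1, 0] * monodromy (fun j => V (j + 1)) E q := by
      simp [monodromy, List.range_succ_eq_map, Function.comp_def]
    rw [e, Matrix.trace_mul_comm, monodromy_succ, hV]

end Monodromy

/-- A trace `z + z⁻¹` yields a solution with Floquet multiplier `z`. The row vectors
`(φ (k + 1), -φ k)` are multiplied by the transfer matrices from the right. -/
theorem exists_bloch {V : ℕ → ℂ} {E z : ℂ} {q : ℕ} (hV : ∀ j, V (j + q) = V j) (hz : z ≠ 0)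
    (h : (monodromy V E q).trace = z + z⁻¹) :
    ∃ φ : ℕ → ℂ, (φ 0 ≠ 0 ∨ φ 1 ≠ 0) ∧
      (∀ k, φ (k + 2) = (E - V (k + 1)) * φ (k + 1) - φ k) ∧ ∀ k, φ (k + q) = z * φ k := by
  have hdet : (monodromy V E q - z • (1 : Matrix (Fin 2) (Fin 2) ℂ)).det = 0 := by
    have h1 := det_monodromy V E q
    rw [Matrix.det_fin_two] at h1 ⊢
    rw [Matrix.trace_fin_two] at h
    simp only [Matrix.sub_apply, Matrix.smul_apply, Matrix.one_apply, smul_eq_mul]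
    simp only [Fin.isValue, if_true, mul_one, zero_ne_one, one_ne_zero, if_false, mul_zero,
      sub_zero]
    have h2 : z * z⁻¹ = 1 := mul_inv_cancel₀ hz
    linear_combination h1 - z * h - h2
  obtain ⟨r, hr, hrM⟩ := Matrix.exists_vecMul_eq_zero_iff.2 hdet
  rw [Matrix.vecMul_sub, Matrix.vecMul_smul, Matrix.vecMul_one, sub_eq_zero] at hrM
  set s : ℕ → Fin 2 → ℂ := fun k => Matrix.vecMul r (monodromy V E k) with hs
  have hs0 : s 0 = r := by simp [hs, monodromy]
  have hsucc : ∀ k, s (k + 1) = ![s k 0 * (E - V (k + 1)) + s k 1, -s k 0] := by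
    intro k
    rw [hs]
    simp only
    rw [monodromy_succ, ← Matrix.vecMul_vecMul]
    ext i
    fin_cases i <;> simp [Matrix.vecMul, dotProduct, Fin.sum_univ_two]
  have h01 : ∀ k, s k 0 = -s (k + 1) 1 := fun k => by rw [hsucc]; simp
  have hrec : ∀ k, -s (k + 2) 1 = (E - V (k + 1)) * -s (k + 1) 1 - -s k 1 := by
    intro k
    rw [← h01 (k + 1), hsucc k]
    simp
    ring
  have hq : s q = z • s 0 := by rw [hs0]; exact hrM
  refine ⟨fun k => -s k 1, ?_, hrec, ?_⟩
  · by_contra! hcon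
    apply hr
    rw [← hs0]
    ext i
    fin_cases i
    · simpa [h01 0] using hcon.2
    · simpa using hcon.1
  · intro k
    induction k using Nat.twoStepInduction with
    | zero => simp [hq]
    | one => simp only; rw [add_comm 1 q, ← h01 q, ← h01 0, hq]; simp
    | more k ih1 ih2 =>
      have e := hrec (k + q)
      simp only at ih1 ih2 ⊢
      rw [show k + 2 + q = k + q + 2 by ring, e, show k + q + 1 = k + 1 + q by ring, ih2, ih1, hV,
        hrec k]
      ring

/-! ### Chambers' formula -/

/-- The potential `2 cos 2π(αj + θ)`, with `ζ = exp (2πiα)` and `w = exp (2πiθ)`. -/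
noncomputable def phasePotential (ζ w : ℂ) (j : ℕ) : ℂ := ζ ^ j * w + (ζ ^ j * w)⁻¹

open Polynomial in
/-- The transfer matrices multiplied by `w`, as matrices of polynomials in `w`. -/
noncomputable def phaseMatrix (ζ E : ℂ) (j : ℕ) : Matrix (Fin 2) (Fin 2) ℂ[X] :=
  !![C E * X - (C (ζ ^ j) * X ^ 2 + C (ζ ^ j)⁻¹), -X; X, 0]

open Polynomial in
/-- The polynomial `w ^ k` times the trace of the monodromy matrix, in the variable `w`. -/
noncomputable def phasePoly (ζ E : ℂ) (k : ℕ) : ℂ[X] :=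
  (((List.range k).map fun i => phaseMatrix ζ E (i + 1)).prod).trace

section Chambers

open Polynomial

theorem phasePoly_eval {ζ E w : ℂ} (hw : w ≠ 0) (k : ℕ) :
    (phasePoly ζ E k).eval w = w ^ k * (monodromy (phasePotential ζ w) E k).trace := by
  have h : (((List.range k).map fun i => phaseMatrix ζ E (i + 1)).prod).map (evalRingHom w)
      = w ^ k • monodromy (phasePotential ζ w) E k := by
    induction k with
    | zero => simp [monodromy]
    | succ k ih =>
      rw [List.range_succ, List.map_append, List.prod_append, Matrix.map_mul, ih, monodromy_succ,
        pow_succ, mul_smul, Matrix.smul_mul, ← Matrix.mul_smul _ w]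
      congr 2
      ext i j
      fin_cases i <;> fin_cases j <;> simp [phaseMatrix, phasePotential]
      field_simp
  have h2 := congrArg Matrix.trace h
  rw [Matrix.trace_smul, smul_eq_mul] at h2
  rw [← h2, phasePoly]
  simp [Matrix.trace_fin_two]

theorem phasePoly_natDegree_le (ζ E : ℂ) (k : ℕ) : (phasePoly ζ E k).natDegree ≤ 2 * k := by
  have h : ∀ i j, (((List.range k).map fun i => phaseMatrix ζ E (i + 1)).prod i j).natDegree
      ≤ 2 * k := by
    induction k with
    | zero => intro i j; fin_cases i <;> fin_cases j <;> simp
    | succ k ih =>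
      intro i j
      have hN : ∀ l, (phaseMatrix ζ E (k + 1) l j).natDegree ≤ 2 := by
        intro l
        fin_cases l <;> fin_cases j <;> simp only [phaseMatrix] <;> simp
        compute_degree
      rw [List.range_succ, List.map_append, List.prod_append, Matrix.mul_apply, Fin.sum_univ_two]
      simp only [List.map_cons, List.map_nil, List.prod_cons, List.prod_nil, mul_one]
      exact natDegree_add_le_of_degree_le
        (natDegree_mul_le_of_le (ih i 0) (hN 0)) (natDegree_mul_le_of_le (ih i 1) (hN 1))
  rw [phasePoly, Matrix.trace_fin_two]
  exact natDegree_add_le_of_degree_le (h 0 0) (h 1 1)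

theorem prod_primitiveRoot_pow {ζ : ℂ} {q : ℕ} (hq : Odd q) (hζ : ζ ^ q = 1) :
    ∏ i ∈ range q, -(ζ ^ (i + 1))⁻¹ = -1 := by
  have h1 : ∏ i ∈ range q, ζ ^ (i + 1) = 1 := by
    rw [prod_pow_eq_pow_sum]
    obtain ⟨m, rfl⟩ := hq
    have : ∑ i ∈ range (2 * m + 1), (i + 1) = (2 * m + 1) * (m + 1) := by
      have := Finset.sum_range_id_mul_two (2 * m + 1 + 1)
      rw [sum_range_succ'] at this
      simp only [add_zero] at this
      have e : (2 * m + 1 + 1) * (2 * m + 1 + 1 - 1) = ((2 * m + 1) * (m + 1)) * 2 := by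
        rw [Nat.add_sub_cancel]; ring
      omega
    rw [this, pow_mul, hζ, one_pow]
  rw [prod_neg, prod_inv_distrib, h1, card_range, hq.neg_one_pow]
  simp

theorem phasePoly_coeff_zero {ζ : ℂ} (E : ℂ) {q : ℕ} (hq : Odd q) (hζ : ζ ^ q = 1) :
    (phasePoly ζ E q).coeff 0 = -1 := by
  have h : ∀ k, 1 ≤ k →
      (((List.range k).map fun i => phaseMatrix ζ E (i + 1)).prod).map (evalRingHom 0)
      = !![∏ i ∈ range k, -(ζ ^ (i + 1))⁻¹, 0; 0, 0] := by
    intro k hk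
    have hN : ∀ j, (phaseMatrix ζ E j).map (evalRingHom 0) = !![-(ζ ^ j)⁻¹, 0; 0, 0] := by
      intro j
      ext a b
      fin_cases a <;> fin_cases b <;> simp [phaseMatrix]
    induction k, hk using Nat.le_induction with
    | base => simpa using hN 1
    | succ k hk ih =>
      rw [List.range_succ, List.map_append, List.prod_append, Matrix.map_mul, ih]
      simp only [List.map_cons, List.map_nil, List.prod_cons, List.prod_nil, mul_one]
      rw [hN, prod_range_succ]
      ext a b
      fin_cases a <;> fin_cases b <;> simp [Matrix.mul_apply, Fin.sum_univ_two]
  have h1 := congrArg Matrix.trace (h q hq.pos)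
  rw [prod_primitiveRoot_pow hq hζ] at h1
  rw [coeff_zero_eq_eval_zero, phasePoly]
  simpa [Matrix.trace_fin_two] using h1

/-- The polynomial in `w` is invariant under `w ↦ ζ w`, hence has only the exponents `0`, `q`
and `2 q`. -/
theorem phasePoly_coeff_eq_zero {ζ : ℂ} (E : ℂ) {q : ℕ} (hq : 0 < q)
    (hζ : IsPrimitiveRoot ζ q) {k : ℕ} (hk : ¬ q ∣ k) : (phasePoly ζ E q).coeff k = 0 := by
  have hζ0 : ζ ≠ 0 := hζ.ne_zero hq.ne'
  have h1 : (phasePoly ζ E q).comp (C ζ * X) = phasePoly ζ E q := by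
    refine eq_of_infinite_eval_eq _ _ (Set.Infinite.mono (s := {w : ℂ | w ≠ 0}) ?_ ?_)
    · intro w hw
      have hw : w ≠ 0 := hw
      have e : phasePotential ζ (ζ * w) = fun j => phasePotential ζ w (j + 1) := by
        funext j
        rw [phasePotential, phasePotential, pow_succ, mul_assoc]
      have hper : phasePotential ζ w (q + 1) = phasePotential ζ w 1 := by
        rw [phasePotential, phasePotential, pow_succ, hζ.pow_eq_one, one_mul, pow_one]
      simp only [Set.mem_ofPred_eq, eval_comp, eval_mul, eval_C, eval_X]
      rw [phasePoly_eval (mul_ne_zero hζ0 hw), phasePoly_eval hw, mul_pow, hζ.pow_eq_one, one_mul,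
        e, trace_monodromy_shift _ _ hper]
    · exact (Set.finite_singleton (0 : ℂ)).infinite_compl
  have h2 := congrArg (fun P => P.coeff k) h1
  simp only [comp_C_mul_X_coeff] at h2
  by_contra h0
  exact hk (hζ.dvd_of_pow_eq_one k (mul_left_cancel₀ h0 (by rw [h2, mul_one])))

theorem trace_monodromy_eq {ζ : ℂ} (E : ℂ) {q : ℕ} (hq : Odd q) (hζ : IsPrimitiveRoot ζ q) :
    ∃ c d : ℂ, ∀ w, w ≠ 0 →
      (monodromy (phasePotential ζ w) E q).trace = c - (w ^ q)⁻¹ + d * w ^ q := by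
  refine ⟨(phasePoly ζ E q).coeff q, (phasePoly ζ E q).coeff (2 * q), fun w hw => ?_⟩
  have h1 := phasePoly_eval (ζ := ζ) (E := E) hw q
  have hq0 := hq.pos
  have h2 : (phasePoly ζ E q).eval w = -1 + (phasePoly ζ E q).coeff q * w ^ q
      + (phasePoly ζ E q).coeff (2 * q) * w ^ (2 * q) := by
    rw [eval_eq_sum_range' (Nat.lt_succ_of_le (phasePoly_natDegree_le ζ E q)),
      ← sum_subset (s₁ := {0, q, 2 * q})]
    · rw [sum_insert (by simp; omega), sum_insert (by simp; omega), sum_singleton,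
        phasePoly_coeff_zero E hq hζ.pow_eq_one]
      ring
    · intro k hk
      simp only [mem_insert, mem_singleton] at hk
      rw [mem_range]
      omega
    · intro k hk hk'
      rw [phasePoly_coeff_eq_zero E hq0 hζ, zero_mul]
      rintro ⟨m, rfl⟩
      rw [mem_range] at hk
      have : m < 3 := by
        by_contra! hm
        have := Nat.mul_le_mul_left q hm
        omega
      interval_cases m <;> simp [mul_comm] at hk'
  have hwq : w ^ q ≠ 0 := pow_ne_zero q hw
  apply mul_left_cancel₀ hwq
  rw [← h1, h2]
  field_simp
  ring

/-- Chambers' formula: the phase enters the trace only through `w ^ q + w ^ (-q)`. The coefficient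
of `w ^ q` is found by replacing `(ζ, w)` with `(ζ⁻¹, w⁻¹)`, which does not alter the potential. -/
theorem chambers {ζ : ℂ} (E : ℂ) {q : ℕ} (hq : Odd q) (hζ : IsPrimitiveRoot ζ q) :
    ∃ c : ℂ, ∀ w, w ≠ 0 →
      (monodromy (phasePotential ζ w) E q).trace = c - (w ^ q + (w ^ q)⁻¹) := by
  obtain ⟨c, d, h⟩ := trace_monodromy_eq E hq hζ
  obtain ⟨c', d', h'⟩ := trace_monodromy_eq E hq hζ.inv
  have key : ∀ w : ℂ, w ≠ 0 → c - (w ^ q)⁻¹ + d * w ^ q = c' - w ^ q + d' * (w ^ q)⁻¹ := by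
    intro w hw
    have e : phasePotential ζ⁻¹ w⁻¹ = phasePotential ζ w := by
      funext j
      rw [phasePotential, phasePotential, inv_pow, ← mul_inv, inv_inv, add_comm]
    have := h' w⁻¹ (inv_ne_zero hw)
    rw [e, h w hw, inv_pow, inv_inv] at this
    exact this
  have hd : d = -1 := by
    have h1 := key 1 one_ne_zero
    have h2 := key (-1) (neg_ne_zero.2 one_ne_zero)
    have h3 := key 2 two_ne_zero
    rw [one_pow, inv_one] at h1
    rw [hq.neg_one_pow, inv_neg, inv_one] at h2
    have hne : ((2 : ℂ) ^ q - (2 ^ q)⁻¹) ≠ 0 := by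
      have h4 : (2 : ℂ) ^ q ≠ 0 := pow_ne_zero q two_ne_zero
      intro h0
      rw [sub_eq_zero, ← mul_eq_one_iff_eq_inv₀ h4, ← mul_pow] at h0
      have h5 : ((2 * 2) ^ q : ℕ) = 1 := by exact_mod_cast h0
      have := Nat.one_lt_pow hq.pos.ne' (show 1 < 2 * 2 by norm_num)
      omega
    have : (d + 1) * ((2 : ℂ) ^ q - (2 ^ q)⁻¹) = 0 := by
      linear_combination h3 - (h1 + h2) / 2 - (2 ^ q)⁻¹ * (h1 - h2) / 2
    rcases mul_eq_zero.1 this with h6 | h6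
    · linear_combination h6
    · exact absurd h6 hne
  refine ⟨c, fun w hw => ?_⟩
  rw [h w hw, hd]
  ring

end Chambers

open Polynomial

/-! ### The discriminant as a real-rooted polynomial -/

/-- The polynomial `-σ`. -/
noncomputable def discPoly (p q : ℕ) : ℝ[X] :=
  (monodromy (fun j => C (2 * Real.cos (2 * Real.pi * j * p / q + Real.pi / (2 * q)))) X q).trace

theorem discriminant_eq (p q : ℕ) (E : ℝ) : discriminant p q E = -(discPoly p q).eval E := by
  have h := map_trace_monodromy
    (fun j : ℕ => C (2 * Real.cos (2 * Real.pi * j * p / q + Real.pi / (2 * q)))) X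
    (evalRingHom E) q
  simp only [coe_evalRingHom, eval_C, eval_X] at h
  rw [discPoly, h]
  rfl

/-- `exp (2πix)` -/
noncomputable def expPhase (x : ℝ) : ℂ := Complex.exp (2 * Real.pi * Complex.I * x)

theorem expPhase_ne_zero (x : ℝ) : expPhase x ≠ 0 := Complex.exp_ne_zero _

theorem expPhase_pow (x : ℝ) (n : ℕ) : expPhase x ^ n = expPhase (n * x) := by
  rw [expPhase, expPhase, ← Complex.exp_nat_mul]
  congr 1
  push_cast
  ring

theorem expPhase_mul (x y : ℝ) : expPhase x * expPhase y = expPhase (x + y) := by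
  rw [expPhase, expPhase, expPhase, ← Complex.exp_add]
  congr 1
  push_cast
  ring

theorem expPhase_add_inv (x : ℝ) :
    expPhase x + (expPhase x)⁻¹ = ((2 * Real.cos (2 * Real.pi * x) : ℝ) : ℂ) := by
  rw [expPhase, ← Complex.exp_neg]
  push_cast
  rw [Complex.two_cos]
  congr 2 <;> ring

theorem norm_expPhase (x : ℝ) : ‖expPhase x‖ = 1 := by
  have := Complex.norm_exp_I_mul_ofReal (2 * Real.pi * x)
  rw [expPhase]
  convert this using 3
  push_cast
  ring

theorem expPhase_primitive {p q : ℕ} (hq : 0 < q) (hpq : Nat.Coprime p q) :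
    IsPrimitiveRoot (expPhase (p / q)) q := by
  have := Complex.isPrimitiveRoot_exp_of_coprime p q hq.ne' hpq
  rw [expPhase]
  push_cast
  exact this

theorem phasePotential_expPhase (a θ : ℝ) (j : ℕ) :
    phasePotential (expPhase a) (expPhase θ) j
      = ((2 * Real.cos (2 * Real.pi * (a * j + θ)) : ℝ) : ℂ) := by
  rw [phasePotential, expPhase_pow, expPhase_mul, expPhase_add_inv, mul_comm a]

theorem phasePotential_periodic {ζ : ℂ} {q : ℕ} (hζ : ζ ^ q = 1) (w : ℂ) (j : ℕ) :
    phasePotential ζ w (j + q) = phasePotential ζ w j := by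
  rw [phasePotential, phasePotential, pow_add, hζ, mul_one]

theorem trace_monodromy_quarter {p q : ℕ} (E : ℂ) :
    (monodromy (phasePotential (expPhase (p / q)) (expPhase (1 / (4 * q)))) E q).trace
      = (discPoly p q).eval₂ Complex.ofRealHom E := by
  have h := map_trace_monodromy
    (fun j : ℕ => C (2 * Real.cos (2 * Real.pi * j * p / q + Real.pi / (2 * q)))) X
    (eval₂RingHom Complex.ofRealHom E) q
  simp only [coe_eval₂RingHom, eval₂_C, eval₂_X] at h
  rw [discPoly, h]
  congr 2
  funext j
  rw [phasePotential_expPhase, Complex.ofRealHom_eq_coe]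
  congr 3
  ring

theorem expPhase_quarter_pow {q : ℕ} (hq : 0 < q) : expPhase (1 / (4 * q)) ^ q = Complex.I := by
  have hq' : (q : ℝ) ≠ 0 := by exact_mod_cast hq.ne'
  rw [expPhase_pow, show (q : ℝ) * (1 / (4 * q)) = 1 / 4 by field_simp, expPhase]
  refine Eq.trans (congrArg Complex.exp ?_) Complex.exp_pi_div_two_mul_I
  push_cast
  ring

/-- At the phase `θ = 1 / 4q` the `θ`-dependent term in Chambers' formula vanishes. -/
theorem trace_monodromy_phase {p q : ℕ} (hq : Odd q) (hpq : Nat.Coprime p q) (E : ℂ) (θ : ℝ) :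
    (monodromy (phasePotential (expPhase (p / q)) (expPhase θ)) E q).trace
      = (discPoly p q).eval₂ Complex.ofRealHom E
        - ((2 * Real.cos (2 * Real.pi * (q * θ)) : ℝ) : ℂ) := by
  obtain ⟨c, hc⟩ := chambers E hq (expPhase_primitive hq.pos hpq)
  have h1 := hc _ (expPhase_ne_zero (1 / (4 * q)))
  rw [trace_monodromy_quarter, expPhase_quarter_pow hq.pos, Complex.inv_I, add_neg_cancel,
    sub_zero] at h1
  rw [hc _ (expPhase_ne_zero θ), h1, expPhase_pow, expPhase_add_inv]

/-- An energy with `-σ(E) ∈ [-4, 4]` admits a Bloch solution at a suitable phase. -/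
theorem exists_bloch_of_abs_le_four {p q : ℕ} (hq : Odd q) (hpq : Nat.Coprime p q) {E : ℂ} {c : ℝ}
    (hE : (discPoly p q).eval₂ Complex.ofRealHom E = c) (hc : |c| ≤ 4) :
    ∃ θ ∈ Set.Ioc (0 : ℝ) 1, ∃ z : ℂ, ‖z‖ = 1 ∧ ∃ φ : ℕ → ℂ, (φ 0 ≠ 0 ∨ φ 1 ≠ 0) ∧
      (∀ k, φ (k + 2) = (E - ((2 * Real.cos (2 * Real.pi * ((p / q : ℝ) * (k + 1 : ℕ) + θ)) : ℝ)
        : ℂ)) * φ (k + 1) - φ k) ∧ ∀ k, φ (k + q) = z * φ k := by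
  have hq0 : (1 : ℝ) ≤ q := by exact_mod_cast hq.pos
  have hpi := Real.pi_pos
  set t := Real.arccos (c / 4)
  have ht0 : 0 ≤ t := Real.arccos_nonneg _
  have ht1 : t ≤ Real.pi := Real.arccos_le_pi _
  rw [abs_le] at hc
  have hcos : Real.cos t = c / 4 := Real.cos_arccos (by linarith) (by linarith)
  -- The choice `2 cos (2πqθ) = c / 2` makes the trace equal to `c / 2`.
  refine ⟨(2 * Real.pi - t) / (2 * Real.pi * q), ⟨by apply div_pos <;> [linarith; positivity], ?_⟩,
    expPhase (t / (2 * Real.pi)), norm_expPhase _, ?_⟩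
  · rw [div_le_one (by positivity)]
    nlinarith
  · have htr := trace_monodromy_phase hq hpq E ((2 * Real.pi - t) / (2 * Real.pi * q))
    rw [hE, show 2 * Real.pi * (q * ((2 * Real.pi - t) / (2 * Real.pi * q))) = 2 * Real.pi - t by
      field_simp, Real.cos_two_pi_sub, hcos] at htr
    have hz := expPhase_add_inv (t / (2 * Real.pi))
    rw [show 2 * Real.pi * (t / (2 * Real.pi)) = t by field_simp, hcos] at hz
    obtain ⟨φ, h0, hrec, hper⟩ := exists_bloch
      (phasePotential_periodic (expPhase_primitive hq.pos hpq).pow_eq_one _)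
      (expPhase_ne_zero (t / (2 * Real.pi))) (by rw [htr, hz]; push_cast; ring)
    exact ⟨φ, h0, fun k => by rw [hrec k, phasePotential_expPhase], hper⟩

theorem sum_range_shift {M : Type*} [AddCommGroup M] {f : ℕ → M} {q : ℕ} (hf : f q = f 0) :
    ∑ n ∈ range q, f (n + 1) = ∑ n ∈ range q, f n := by
  have h := sum_range_succ' f q
  rw [sum_range_succ, hf] at h
  exact (add_right_cancel h).symm

/-- Bloch solutions with a multiplier of modulus one exist only at real energies. -/
theorem im_eq_zero_of_bloch {v : ℕ → ℝ} {E z : ℂ} {q : ℕ} (hz : ‖z‖ = 1) {φ : ℕ → ℂ}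
    (h0 : φ 0 ≠ 0 ∨ φ 1 ≠ 0) (hrec : ∀ k, φ (k + 2) = (E - (v k : ℂ)) * φ (k + 1) - φ k)
    (hper : ∀ k, φ (k + q) = z * φ k) (hq : 0 < q) : E.im = 0 := by
  have hzz : z * star z = 1 := by
    have := Complex.mul_conj z
    rw [Complex.normSq_eq_norm_sq, hz] at this
    simpa using this
  have hshift := sum_range_shift (f := fun n => star (φ n) * φ (n + 1)) (q := q) (by
    have h1 := hper 0
    have h2 := hper 1
    rw [zero_add] at h1
    rw [add_comm] at h2
    rw [h1, h2, star_mul', zero_add]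
    linear_combination star (φ 0) * φ 1 * hzz)
  have hE : E * ∑ n ∈ range q, star (φ (n + 1)) * φ (n + 1)
      = ∑ n ∈ range q, (v n : ℂ) * (star (φ (n + 1)) * φ (n + 1))
        + (∑ n ∈ range q, star (φ n) * φ (n + 1)
        + ∑ n ∈ range q, star (star (φ n) * φ (n + 1))) := by
    rw [← hshift, mul_sum, ← sum_add_distrib, ← sum_add_distrib]
    refine sum_congr rfl fun n _ => ?_
    rw [star_mul', star_star]
    linear_combination -star (φ (n + 1)) * hrec n
  have hnorm : ∀ n, star (φ n) * φ n = ((‖φ n‖ ^ 2 : ℝ) : ℂ) := by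
    intro n
    rw [mul_comm, ← Complex.normSq_eq_norm_sq]
    exact Complex.mul_conj _
  have him := congrArg Complex.im hE
  have e1 : ∑ n ∈ range q, star (φ (n + 1)) * φ (n + 1)
      = ((∑ n ∈ range q, ‖φ (n + 1)‖ ^ 2 : ℝ) : ℂ) := by
    push_cast
    exact sum_congr rfl fun n _ => by rw [hnorm]; push_cast; rfl
  have e2 : ∑ n ∈ range q, (v n : ℂ) * (star (φ (n + 1)) * φ (n + 1))
      = ((∑ n ∈ range q, v n * ‖φ (n + 1)‖ ^ 2 : ℝ) : ℂ) := by
    push_cast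
    exact sum_congr rfl fun n _ => by rw [hnorm]; push_cast; rfl
  have e3 : (∑ n ∈ range q, star (φ n) * φ (n + 1)
      + ∑ n ∈ range q, star (star (φ n) * φ (n + 1))).im = 0 := by
    rw [← star_sum, Complex.add_im, Complex.star_def, Complex.conj_im, add_neg_cancel]
  rw [e1, e2, Complex.add_im, e3, Complex.im_mul_ofReal, Complex.ofReal_im, add_zero] at him
  rcases mul_eq_zero.1 him with h | h
  · exact h
  · exfalso
    rw [sum_eq_zero_iff_of_nonneg fun n _ => by positivity] at h
    have hz0 : z ≠ 0 := by
      rintro rfl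
      simp at hz
    have hv : ∀ n < q, φ (n + 1) = 0 := fun n hn => by simpa using h n (mem_range.2 hn)
    have h1 : φ 1 = 0 := hv 0 hq
    have h2 : φ 0 = 0 := by
      have := hper 0
      rw [zero_add] at this
      have h3 := hv (q - 1) (by omega)
      rw [Nat.sub_add_cancel hq, this] at h3
      exact (mul_eq_zero.1 h3).resolve_left hz0
    tauto

theorem monic_trace_monodromy (v : ℕ → ℝ) {q : ℕ} (hq : 0 < q) :
    (monodromy (fun j => C (v j)) X q).trace.Monic ∧
      (monodromy (fun j => C (v j)) X q).trace.natDegree = q := by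
  have key : ∀ k, (monodromy (fun j => C (v j)) X (k + 1) 0 0).Monic ∧
      (monodromy (fun j => C (v j)) X (k + 1) 0 0).natDegree = k + 1 ∧
      (monodromy (fun j => C (v j)) X (k + 1) 0 1).natDegree ≤ k ∧
      (monodromy (fun j => C (v j)) X (k + 1) 1 0).natDegree ≤ k ∧
      (monodromy (fun j => C (v j)) X (k + 1) 1 1).natDegree ≤ k := by
    intro k
    induction k with
    | zero =>
      have e : monodromy (fun j => C (v j)) X (0 + 1) = !![X - C (v 1), -1; 1, 0] := by
        simp [monodromy]
      rw [e]
      refine ⟨?_, ?_, ?_, ?_, ?_⟩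
      · exact monic_X_sub_C (v 1)
      · exact natDegree_X_sub_C (v 1)
      all_goals simp
    | succ k ih =>
      obtain ⟨m, d, h01, h10, h11⟩ := ih
      rw [monodromy_succ]
      set A := monodromy (fun j => C (v j)) X (k + 1)
      have hX : (X - C (v (k + 1 + 1))).Monic := monic_X_sub_C _
      have hd : (A 0 0 * (X - C (v (k + 1 + 1)))).natDegree = k + 1 + 1 := by
        rw [Monic.natDegree_mul m hX, d, natDegree_X_sub_C]
      have l01 : (A 0 1).degree < (A 0 0 * (X - C (v (k + 1 + 1)))).degree :=
        degree_lt_degree (by omega)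
      rw [Matrix.mul_apply, Matrix.mul_apply, Matrix.mul_apply, Matrix.mul_apply]
      simp only [Fin.sum_univ_two, Matrix.of_apply, Matrix.cons_val_zero, Matrix.cons_val_one,
        mul_one, mul_neg, mul_zero, add_zero, natDegree_neg]
      refine ⟨(m.mul hX).add_of_left l01, ?_, d.le, ?_, by omega⟩
      · rw [natDegree_add_eq_left_of_degree_lt l01, hd]
      · exact natDegree_add_le_of_degree_le
          (natDegree_mul_le_of_le h10 (natDegree_X_sub_C _).le) (by omega)
  obtain ⟨k, rfl⟩ := Nat.exists_eq_succ_of_ne_zero hq.ne'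
  obtain ⟨m, d, -, -, h11⟩ := key k
  have l11 : (monodromy (fun j => C (v j)) X (k + 1) 1 1).degree
      < (monodromy (fun j => C (v j)) X (k + 1) 0 0).degree := degree_lt_degree (by omega)
  rw [Matrix.trace_fin_two]
  exact ⟨m.add_of_left l11, by rw [natDegree_add_eq_left_of_degree_lt l11, d]⟩

theorem discPoly_monic (p : ℕ) {q : ℕ} (hq : 0 < q) : (discPoly p q).Monic :=
  (monic_trace_monodromy _ hq).1

theorem discPoly_natDegree (p : ℕ) {q : ℕ} (hq : 0 < q) : (discPoly p q).natDegree = q :=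
  (monic_trace_monodromy _ hq).2

/-- For `|c| ≤ 4` the polynomial `-σ - c` has only real roots. -/
theorem exists_real_roots {p q : ℕ} (hq : Odd q) (hpq : Nat.Coprime p q) {c : ℝ} (hc : |c| ≤ 4) :
    ∃ s : Multiset ℝ, s ≠ 0 ∧ discPoly p q - C c = (s.map fun r => X - C r).prod := by
  have hm := discPoly_monic p hq.pos
  have hd := discPoly_natDegree p hq.pos
  have hm' : (discPoly p q - C c).Monic :=
    hm.sub_of_left (degree_lt_degree (by rw [natDegree_C, hd]; exact hq.pos))
  have hd' : (discPoly p q - C c).natDegree = q := by rw [natDegree_sub_C, hd]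
  set P := discPoly p q - C c
  have hreal : ∀ r ∈ (P.map Complex.ofRealHom).roots, ((r.re : ℝ) : ℂ) = r := by
    intro r hr
    have hr := (mem_roots'.1 hr).2
    rw [IsRoot.def, eval_map, eval₂_sub, eval₂_C, sub_eq_zero] at hr
    obtain ⟨θ, -, z, hz, φ, h0, hrec, hper⟩ := exists_bloch_of_abs_le_four hq hpq hr hc
    have him := im_eq_zero_of_bloch hz h0 hrec hper hq.pos
    exact Complex.ext (by simp) (by simp [him])
  have hsplit := (IsAlgClosed.splits (P.map Complex.ofRealHom)).eq_prod_roots_of_monic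
    (hm'.map Complex.ofRealHom)
  have hPs : P = (((P.map Complex.ofRealHom).roots.map Complex.re).map fun r => X - C r).prod := by
    apply Polynomial.map_injective Complex.ofRealHom Complex.ofRealHom.injective
    rw [Polynomial.map_multiset_prod, Multiset.map_map, Multiset.map_map]
    conv_lhs => rw [hsplit]
    congr 1
    refine Multiset.map_congr rfl fun r hr => ?_
    simp [hreal r hr]
  refine ⟨_, fun h0 => ?_, hPs⟩
  rw [h0] at hPs
  simp only [Multiset.map_zero, Multiset.prod_zero] at hPs
  rw [hPs, natDegree_one] at hd'
  exact hq.pos.ne hd'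

/-- Laguerre's inequality for real-rooted polynomials. -/
theorem laguerre (s : Multiset ℝ) (x : ℝ) :
    0 ≤ ((s.map fun r => X - C r).prod.derivative.eval x) ^ 2
      - (s.map fun r => X - C r).prod.eval x
        * (s.map fun r => X - C r).prod.derivative.derivative.eval x ∧
    (s ≠ 0 → (s.map fun r => X - C r).prod.eval x ≠ 0 →
      0 < ((s.map fun r => X - C r).prod.derivative.eval x) ^ 2
        - (s.map fun r => X - C r).prod.eval x
          * (s.map fun r => X - C r).prod.derivative.derivative.eval x) := by
  induction s using Multiset.induction_on with
  | empty => simp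
  | cons r s ih =>
    simp only [Multiset.map_cons, Multiset.prod_cons]
    set Q := (s.map fun r => X - C r).prod
    have e : ((X - C r) * Q).derivative.eval x ^ 2
        - ((X - C r) * Q).eval x * ((X - C r) * Q).derivative.derivative.eval x
        = Q.eval x ^ 2 + (x - r) ^ 2 * (Q.derivative.eval x ^ 2
          - Q.eval x * Q.derivative.derivative.eval x) := by
      simp only [derivative_mul, derivative_sub, derivative_X, derivative_C, sub_zero, one_mul,
        eval_add, eval_mul, eval_sub, eval_X, eval_C, derivative_add]
      ring
    rw [e]
    have := ih.1
    refine ⟨by positivity, fun _ h => ?_⟩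
    have hQ : Q.eval x ≠ 0 := by
      intro h0
      simp [h0] at h
    positivity

/-- Between two bands the discriminant reaches modulus at least `4`: otherwise Laguerre's inequality
for `-σ - 4` and `-σ + 4` gives the second derivative both signs. -/
theorem four_le_abs_of_critical {p q : ℕ} (hq : Odd q) (hpq : Nat.Coprime p q) {x : ℝ}
    (hx : (discPoly p q).derivative.eval x = 0) : 4 ≤ |(discPoly p q).eval x| := by
  by_contra! h
  rw [abs_lt] at h
  have key : ∀ c : ℝ, |c| ≤ 4 → (discPoly p q).eval x ≠ c →
      ((discPoly p q).eval x - c) * (discPoly p q).derivative.derivative.eval x < 0 := by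
    intro c hc hne
    obtain ⟨s, hs, hP⟩ := exists_real_roots hq hpq hc
    have := (laguerre s x).2 hs
    rw [← hP] at this
    simp only [derivative_sub, derivative_C, sub_zero, hx, eval_sub, eval_C] at this
    linarith [this (sub_ne_zero.2 hne)]
  have h1 := key 4 (by norm_num) h.2.ne
  have h2 := key (-4) (by norm_num) h.1.ne'
  rcases lt_or_ge 0 ((discPoly p q).derivative.derivative.eval x) with h3 | h3 <;> nlinarith

/-! ### The unitarily equivalent chain -/

/-- The characteristic polynomials of the truncations of the Jacobi matrix with zero diagonal and
squared off-diagonal entries `bond α j`. -/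
noncomputable def chainPoly (α : ℝ) : ℕ → ℝ[X]
  | 0 => 1
  | 1 => X
  | n + 2 => X * chainPoly α (n + 1) - C (bond α (n + 1)) * chainPoly α n

theorem chainPoly_monic_natDegree (α : ℝ) (n : ℕ) :
    ((chainPoly α n).Monic ∧ (chainPoly α n).natDegree = n) ∧
      (chainPoly α (n + 1)).Monic ∧ (chainPoly α (n + 1)).natDegree = n + 1 := by
  induction n with
  | zero => exact ⟨⟨monic_one, natDegree_one⟩, monic_X, natDegree_X⟩
  | succ n ih =>
    obtain ⟨⟨m0, d0⟩, m1, d1⟩ := ih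
    refine ⟨⟨m1, d1⟩, ?_⟩
    rw [show n + 1 + 1 = n + 2 from rfl, chainPoly]
    have hd : (X * chainPoly α (n + 1)).natDegree = n + 2 := by
      rw [Monic.natDegree_mul monic_X m1, d1, natDegree_X]; ring
    have hlt : (C (bond α (n + 1)) * chainPoly α n).natDegree
        < (X * chainPoly α (n + 1)).natDegree :=
      (natDegree_C_mul_le _ _).trans_lt (by omega)
    exact ⟨(monic_X.mul m1).sub_of_left (degree_lt_degree hlt),
      by rw [natDegree_sub_eq_left_of_natDegree_lt hlt, hd]⟩

theorem chainPoly_eval_neg (α : ℝ) (n : ℕ) (x : ℝ) :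
    (chainPoly α n).eval (-x) = (-1) ^ n * (chainPoly α n).eval x := by
  induction n using Nat.twoStepInduction with
  | zero => simp [chainPoly]
  | one => simp [chainPoly]
  | more n ih1 ih2 =>
    simp only [chainPoly, eval_sub, eval_mul, eval_X, eval_C, ih1, ih2]
    ring

theorem sum_range_shift_of_periodic {M : Type*} [AddCommGroup M] {f : ℕ → M} {q : ℕ}
    (hf : ∀ n, f (n + q) = f n) (m : ℕ) :
    ∑ n ∈ range q, f (n + m) = ∑ n ∈ range q, f n := by
  induction m with
  | zero => rfl
  | succ m ih =>
    rw [← ih, ← sum_range_shift (f := fun n => f (n + m)) (by rw [add_comm, hf, zero_add])]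
    exact sum_congr rfl fun n _ => by rw [add_right_comm, add_assoc]

/-- The quadratic phase `∏ (-ζ⁻ⁱ w⁻¹)`, `i = 1, …, n`: summation against it turns the
multiplication by `ζⁿ w` into minus the translation `n ↦ n + 1`. -/
noncomputable def gaussKernel (ζ w : ℂ) (n : ℕ) : ℂ := ∏ i ∈ range n, -(ζ ^ (i + 1) * w)⁻¹

theorem gaussKernel_succ (ζ w : ℂ) (n : ℕ) :
    gaussKernel ζ w (n + 1) = gaussKernel ζ w n * -(ζ ^ (n + 1) * w)⁻¹ :=
  prod_range_succ _ _

theorem gaussKernel_ne_zero {ζ w : ℂ} (hζ : ζ ≠ 0) (hw : w ≠ 0) (n : ℕ) :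
    gaussKernel ζ w n ≠ 0 :=
  prod_ne_zero_iff.2 fun _ _ =>
    neg_ne_zero.2 (inv_ne_zero (mul_ne_zero (pow_ne_zero _ hζ) hw))

theorem gaussKernel_add {ζ w : ℂ} (hζ : ζ ≠ 0) (n m : ℕ) :
    ζ ^ (n * m) * gaussKernel ζ w (n + m) = gaussKernel ζ w n * gaussKernel ζ w m := by
  induction m with
  | zero => simp [gaussKernel]
  | succ m ih =>
    rw [← add_assoc, gaussKernel_succ, gaussKernel_succ, ← mul_assoc (gaussKernel ζ w n), ← ih]
    rw [mul_add, pow_add, mul_one, show n + m + 1 = n + (m + 1) by ring, pow_add ζ n (m + 1)]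
    have := pow_ne_zero n hζ
    rw [mul_assoc (ζ ^ n) _ w, mul_inv (ζ ^ n)]
    field_simp

theorem gaussKernel_period {ζ w : ℂ} {q : ℕ} (hq : Odd q) (hζ : ζ ^ q = 1) :
    gaussKernel ζ w q = -(w ^ q)⁻¹ := by
  have h := prod_primitiveRoot_pow hq hζ
  have : gaussKernel ζ w q = (∏ i ∈ range q, -(ζ ^ (i + 1))⁻¹) * ∏ _i ∈ range q, w⁻¹ := by
    rw [gaussKernel, ← prod_mul_distrib]
    exact prod_congr rfl fun i _ => by rw [mul_inv, neg_mul]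
  rw [this, h, prod_const, card_range, inv_pow, neg_one_mul]

/-- Transforms of a Bloch solution with multiplier `-w ^ q` satisfy the eigenvalue equation of the
chain; the bond between the sites `q` and `q + 1` is broken as `ζ ^ q = 1`. -/
theorem gauss_transform_recurrence {ζ w E : ℂ} {q : ℕ} (hq : Odd q) (hζ : ζ ^ q = 1) (hw : w ≠ 0)
    {φ : ℕ → ℂ} (hrec : ∀ k, φ (k + 2) = (E - phasePotential ζ w (k + 1)) * φ (k + 1) - φ k)
    (hper : ∀ k, φ (k + q) = -w ^ q * φ k) (m : ℕ) :
    E * ∑ n ∈ range q, gaussKernel ζ w n * φ (n + (m + 1))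
      = (1 - ζ ^ (m + 1)) * ∑ n ∈ range q, gaussKernel ζ w n * φ (n + (m + 2))
        + (1 - (ζ ^ m)⁻¹) * ∑ n ∈ range q, gaussKernel ζ w n * φ (n + m) := by
  have hζ0 : ζ ≠ 0 := by
    rintro rfl
    rw [zero_pow hq.pos.ne'] at hζ
    exact zero_ne_one hζ
  have hwq : w ^ q ≠ 0 := pow_ne_zero q hw
  have hk : ∀ n, gaussKernel ζ w (n + q) = -(w ^ q)⁻¹ * gaussKernel ζ w n := by
    intro n
    have := gaussKernel_add (w := w) hζ0 n q
    rw [mul_comm n, pow_mul, hζ, one_pow, one_mul, gaussKernel_period hq hζ] at this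
    rw [this, mul_comm]
  have hpow : ∀ n, ζ ^ (n + q) = ζ ^ n := fun n => by rw [pow_add, hζ, mul_one]
  have s1 : ∑ n ∈ range q, gaussKernel ζ w n * (ζ ^ (n + (m + 1)) * w * φ (n + (m + 1)))
      = -ζ ^ (m + 1) * ∑ n ∈ range q, gaussKernel ζ w n * φ (n + (m + 2)) := by
    rw [← sum_range_shift_of_periodic
      (f := fun n => gaussKernel ζ w n * (ζ ^ (n + (m + 1)) * w * φ (n + (m + 1)))) (q := q)
      (fun n => ?_) 1, mul_sum]
    · refine sum_congr rfl fun n _ => ?_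
      rw [gaussKernel_succ, show n + 1 + (m + 1) = n + (m + 2) by ring,
        show n + (m + 2) = (n + 1) + (m + 1) by ring, pow_add ζ (n + 1) (m + 1)]
      have := pow_ne_zero (n + 1) hζ0
      field_simp
    · rw [show n + q + (m + 1) = n + (m + 1) + q by ring, hk, hpow, hper]
      field_simp
  have s2 : ∑ n ∈ range q, gaussKernel ζ w n * ((ζ ^ (n + (m + 1)) * w)⁻¹ * φ (n + (m + 1)))
      = -(ζ ^ m)⁻¹ * ∑ n ∈ range q, gaussKernel ζ w n * φ (n + m) := by
    rw [← sum_range_shift_of_periodic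
      (f := fun n => gaussKernel ζ w n * φ (n + m)) (q := q) (fun n => ?_) 1, mul_sum]
    · refine sum_congr rfl fun n _ => ?_
      rw [gaussKernel_succ, show n + 1 + m = n + (m + 1) by ring,
        show n + (m + 1) = (n + 1) + m by ring, pow_add ζ (n + 1) m]
      have := pow_ne_zero (n + 1) hζ0
      field_simp
    · rw [show n + q + m = n + m + q by ring, hk, hper]
      field_simp
  have s3 : E * ∑ n ∈ range q, gaussKernel ζ w n * φ (n + (m + 1))
      = ∑ n ∈ range q, gaussKernel ζ w n * φ (n + (m + 2))
        + ∑ n ∈ range q, gaussKernel ζ w n * φ (n + m)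
        + ∑ n ∈ range q, gaussKernel ζ w n * (ζ ^ (n + (m + 1)) * w * φ (n + (m + 1)))
        + ∑ n ∈ range q, gaussKernel ζ w n * ((ζ ^ (n + (m + 1)) * w)⁻¹ * φ (n + (m + 1))) := by
    rw [mul_sum, ← sum_add_distrib, ← sum_add_distrib, ← sum_add_distrib]
    refine sum_congr rfl fun n _ => ?_
    have := hrec (n + m)
    rw [phasePotential] at this
    rw [← add_assoc, ← add_assoc, this]
    ring
  rw [s3, s1, s2]
  ring

/-- The transform is injective on Bloch solutions, being a discrete Fourier transform up to unit
factors. -/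
theorem exists_gauss_transform_ne_zero {ζ w : ℂ} {q : ℕ} (hq : Odd q) (hζ : IsPrimitiveRoot ζ q)
    (hw : w ≠ 0) {φ : ℕ → ℂ} (h0 : φ 0 ≠ 0 ∨ φ 1 ≠ 0)
    (hper : ∀ k, φ (k + q) = -w ^ q * φ k) :
    ∃ m < q, ∑ n ∈ range q, gaussKernel ζ w n * φ (n + (m + 1)) ≠ 0 := by
  by_contra! hcon
  have hζ0 : ζ ≠ 0 := hζ.ne_zero hq.pos.ne'
  have hwq : w ^ q ≠ 0 := pow_ne_zero q hw
  have hk : ∀ n, gaussKernel ζ w (n + q) = -(w ^ q)⁻¹ * gaussKernel ζ w n := by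
    intro n
    have := gaussKernel_add (w := w) hζ0 n q
    rw [mul_comm n, pow_mul, hζ.pow_eq_one, one_pow, one_mul,
      gaussKernel_period hq hζ.pow_eq_one] at this
    rw [this, mul_comm]
  have hdft : ∀ m < q, ∑ n ∈ range q, ζ ^ (n * (m + 1)) * (gaussKernel ζ w n * φ n) = 0 := by
    intro m hm
    rw [← sum_range_shift_of_periodic
      (f := fun n => ζ ^ (n * (m + 1)) * (gaussKernel ζ w n * φ n)) (q := q) (fun n => ?_) (m + 1)]
    · have : ∀ n ∈ range q, ζ ^ ((n + (m + 1)) * (m + 1))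
          * (gaussKernel ζ w (n + (m + 1)) * φ (n + (m + 1)))
          = ζ ^ ((m + 1) * (m + 1)) * gaussKernel ζ w (m + 1)
            * (gaussKernel ζ w n * φ (n + (m + 1))) := by
        intro n _
        rw [add_mul, pow_add]
        linear_combination (ζ ^ ((m + 1) * (m + 1)) * φ (n + (m + 1)))
          * gaussKernel_add (w := w) hζ0 n (m + 1)
      rw [sum_congr rfl this, ← mul_sum, hcon m hm, mul_zero]
    · rw [add_mul, pow_add, pow_mul ζ q, hζ.pow_eq_one, one_pow, hk, hper]
      field_simp
  have hvan := Matrix.eq_zero_of_forall_index_sum_pow_mul_eq_zero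
    (f := fun j : Fin q => ζ ^ (j.1 + 1)) (v := fun i : Fin q => gaussKernel ζ w i * φ i)
    (fun i j hij => by
      simp only [pow_succ] at hij
      exact Fin.ext (hζ.pow_inj i.2 j.2 (mul_right_cancel₀ hζ0 hij)))
    (fun j => by
      rw [← hdft j.1 j.2, sum_range]
      exact sum_congr rfl fun i _ => by rw [← pow_mul, mul_comm i.1])
  have hφ : ∀ n < q, φ n = 0 := by
    intro n hn
    have := congrFun hvan ⟨n, hn⟩
    exact (mul_eq_zero.1 this).resolve_left (gaussKernel_ne_zero hζ0 hw n)
  have hφ0 := hφ 0 hq.pos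
  have hφ1 : φ 1 = 0 := by
    rcases Nat.lt_or_ge 1 q with h | h
    · exact hφ 1 h
    · have : q = 1 := by have := hq.pos; omega
      have h2 := hper 0
      rwa [this, hφ0, mul_zero] at h2
  tauto

theorem bond_eq_mul {ζ : ℂ} {a : ℝ} (hζ : ζ = expPhase a) (m : ℕ) :
    ((bond a m : ℝ) : ℂ) = (1 - ζ ^ m) * (1 - (ζ ^ m)⁻¹) := by
  have h := expPhase_add_inv (m * a)
  rw [← expPhase_pow, ← hζ] at h
  have hz : ζ ^ m * (ζ ^ m)⁻¹ = 1 :=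
    mul_inv_cancel₀ (pow_ne_zero m (hζ ▸ expPhase_ne_zero a))
  have e : bond a m = 2 - 2 * Real.cos (2 * Real.pi * (m * a)) := by
    rw [bond, mul_assoc 2 Real.pi, Real.cos_two_mul, mul_pow, Real.sin_sq]
    ring
  rw [e]
  push_cast at h ⊢
  linear_combination h - hz

theorem chainPoly_eval_eq_zero {p q : ℕ} (hq : Odd q) (hpq : Nat.Coprime p q) {E : ℝ}
    (hE : (discPoly p q).eval E = 0) : (chainPoly (p / q) q).eval E = 0 := by
  set ζ := expPhase (p / q) with hζdef
  set w := expPhase (1 / (4 * q)) with hwdef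
  have hζ : IsPrimitiveRoot ζ q := expPhase_primitive hq.pos hpq
  have hw : w ≠ 0 := expPhase_ne_zero _
  have hwq : w ^ q = Complex.I := expPhase_quarter_pow hq.pos
  have htr := trace_monodromy_quarter (p := p) (q := q) (E : ℂ)
  rw [← Complex.ofRealHom_eq_coe, eval₂_at_apply, hE, map_zero] at htr
  obtain ⟨φ, h0, hrec, hper⟩ := exists_bloch
    (phasePotential_periodic hζ.pow_eq_one w) (neg_ne_zero.2 (pow_ne_zero q hw))
    (show _ = -w ^ q + (-w ^ q)⁻¹ by rw [htr, hwq, inv_neg, Complex.inv_I]; ring)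
  set ψ : ℕ → ℂ := fun m => ∑ n ∈ range q, gaussKernel ζ w n * φ (n + m) with hψ
  have hψrec : ∀ m, (E : ℂ) * ψ (m + 1) = (1 - ζ ^ (m + 1)) * ψ (m + 2) + (1 - (ζ ^ m)⁻¹) * ψ m :=
    gauss_transform_recurrence hq hζ.pow_eq_one hw hrec hper
  have hchain : ∀ m, (∏ i ∈ range m, (1 - ζ ^ (i + 1))) * ψ (m + 1)
      = ((chainPoly (p / q) m).eval E : ℝ) * ψ 1 := by
    intro m
    induction m using Nat.twoStepInduction with
    | zero => simp [chainPoly]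
    | one =>
      have := hψrec 0
      simp only [zero_add, pow_one, pow_zero, inv_one, sub_self, zero_mul, add_zero] at this
      simp [chainPoly, this]
    | more m ih1 ih2 =>
      have hb := bond_eq_mul hζdef (m + 1)
      rw [prod_range_succ] at ih2
      rw [prod_range_succ, prod_range_succ]
      simp only [chainPoly, eval_sub, eval_mul, eval_X, eval_C]
      push_cast at hb ⊢
      linear_combination (E : ℂ) * ih2 - ((bond (p / q) (m + 1) : ℝ) : ℂ) * ih1
        - (∏ i ∈ range m, (1 - ζ ^ (i + 1))) * (1 - ζ ^ (m + 1)) * hψrec (m + 1)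
        + (∏ i ∈ range m, (1 - ζ ^ (i + 1))) * ψ (m + 1) * hb
  have hψ1 : ψ 1 ≠ 0 := by
    intro h1
    obtain ⟨m, hm, hne⟩ := exists_gauss_transform_ne_zero hq hζ hw h0 hper
    have := hchain m
    rw [h1, mul_zero] at this
    rcases mul_eq_zero.1 this with h2 | h2
    · rw [prod_eq_zero_iff] at h2
      obtain ⟨i, hi, hi0⟩ := h2
      have := mem_range.1 hi
      exact hζ.pow_ne_one_of_pos_of_lt (Nat.succ_ne_zero i) (by omega) (sub_eq_zero.1 hi0).symm
    · exact hne h2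
  have hlast := hchain q
  have hzero : ∏ i ∈ range q, (1 - ζ ^ (i + 1)) = 0 :=
    prod_eq_zero (i := q - 1) (mem_range.2 (by have := hq.pos; omega))
      (by rw [Nat.sub_add_cancel hq.pos, hζ.pow_eq_one, sub_self])
  rw [hzero, zero_mul] at hlast
  have := (mul_eq_zero.1 hlast.symm).resolve_right hψ1
  exact_mod_cast this

theorem discPoly_eq_chainPoly {p q : ℕ} (hq : Odd q) (hpq : Nat.Coprime p q) :
    discPoly p q = chainPoly (p / q) q := by
  have hm := discPoly_monic p hq.pos
  have hd := discPoly_natDegree p hq.pos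
  obtain ⟨hm', hd'⟩ := (chainPoly_monic_natDegree (p / q) q).1
  obtain ⟨s, -, hs⟩ := exists_real_roots hq hpq (c := 0) (by norm_num)
  rw [C_0, sub_zero] at hs
  have hroots : (discPoly p q).roots = s := by rw [hs, roots_multiset_prod_X_sub_C]
  have hcard : Multiset.card (discPoly p q).roots = q := by
    rw [hroots, ← natDegree_multiset_prod_X_sub_C_eq_card, ← hs, hd]
  have hnodup : (discPoly p q).roots.Nodup := by
    classical
    rw [Multiset.nodup_iff_count_le_one]
    intro x
    rw [count_roots]
    by_contra! h
    obtain ⟨h1, h2⟩ := (one_lt_rootMultiplicity_iff_isRoot hm.ne_zero).1 h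
    have := four_le_abs_of_critical hq hpq h2
    rw [IsRoot.def.1 h1, abs_zero] at this
    linarith
  refine eq_of_degree_sub_lt_of_eval_finset_eq ⟨(discPoly p q).roots, hnodup⟩ ?_ fun x hx => ?_
  · refine (degree_sub_lt_left ?_ hm.ne_zero ?_).trans_le ?_
    · rw [degree_eq_natDegree hm.ne_zero, degree_eq_natDegree hm'.ne_zero, hd, hd']
    · rw [hm.leadingCoeff, hm'.leadingCoeff]
    · rw [degree_eq_natDegree hm.ne_zero, hd, Finset.card_mk, hcard]
  · have h1 : (discPoly p q).eval x = 0 := (mem_roots'.1 hx).2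
    rw [h1, chainPoly_eval_eq_zero hq hpq h1]

/-! ### The slope of the discriminant at zero -/

theorem chainPoly_eval_zero (α : ℝ) (m : ℕ) :
    (chainPoly α (2 * m)).eval 0 = (-1) ^ m * oddProd α m ∧
      (chainPoly α (2 * m + 1)).eval 0 = 0 := by
  induction m with
  | zero => simp [chainPoly, oddProd]
  | succ m ih =>
    have e : oddProd α (m + 1) = oddProd α m * bond α (2 * m + 1) := prod_range_succ _ _
    rw [show 2 * (m + 1) = 2 * m + 2 by ring, show 2 * m + 2 + 1 = (2 * m + 1) + 2 by ring]
    simp only [chainPoly, eval_sub, eval_mul, eval_X, eval_C, ih.1, e, zero_mul]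
    rw [ih.2]
    constructor <;> ring

theorem chainPoly_derivative_eval_zero {x : ℚ} (h : ℕ) (hh : 2 * h < x.den) :
    (chainPoly x (2 * h + 1)).derivative.eval 0
      = (-1) ^ h * ∑ i ∈ range (h + 1), oddProd x i * (evenProd x h / evenProd x i) := by
  induction h with
  | zero => simp [chainPoly, oddProd, evenProd]
  | succ h ih =>
    have h0 := chainPoly_eval_zero x (h + 1)
    have e : evenProd x (h + 1) = evenProd x h * bond x (2 * h + 2) := prod_range_succ _ _
    have hne := (evenProd_pos hh).ne'
    have hsum : ∑ i ∈ range (h + 1 + 1), oddProd x i * (evenProd x (h + 1) / evenProd x i)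
        = bond x (2 * h + 2) * ∑ i ∈ range (h + 1), oddProd x i * (evenProd x h / evenProd x i)
          + oddProd x (h + 1) := by
      rw [sum_range_succ, div_self hne, mul_one, mul_sum]
      congr 1
      exact sum_congr rfl fun i _ => by rw [e]; ring
    have h1 := h0.1
    rw [show 2 * (h + 1) = 2 * h + 1 + 1 by ring] at h1
    have e2 : chainPoly x (2 * h + 1 + 2) = X * chainPoly x (2 * h + 1 + 1)
      - C (bond x (2 * h + 1 + 1)) * chainPoly x (2 * h + 1) := rfl
    rw [hsum, show 2 * (h + 1) + 1 = 2 * h + 1 + 2 by ring, e2]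
    simp only [derivative_sub, derivative_mul, derivative_X, derivative_C, eval_sub,
      eval_add, eval_mul, eval_X, eval_C, eval_one, h1, ih (by omega), eval_zero]
    ring

/-! ### The linear bound on the central band -/

theorem discPoly_eval_neg {p q : ℕ} (hq : Odd q) (hpq : Nat.Coprime p q) (x : ℝ) :
    (discPoly p q).eval (-x) = -(discPoly p q).eval x := by
  rw [discPoly_eq_chainPoly hq hpq, chainPoly_eval_neg, hq.neg_one_pow, neg_one_mul]

theorem discPoly_eval_zero {p q : ℕ} (hq : Odd q) (hpq : Nat.Coprime p q) :
    (discPoly p q).eval 0 = 0 := by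
  have := discPoly_eval_neg hq hpq 0
  rw [neg_zero] at this
  linarith

theorem discPoly_derivative_ne_zero {p q : ℕ} (hq : Odd q) (hpq : Nat.Coprime p q) :
    (discPoly p q).derivative.eval 0 ≠ 0 := by
  intro h
  have := four_le_abs_of_critical hq hpq h
  rw [discPoly_eval_zero hq hpq, abs_zero] at this
  linarith

/-- Up to its first positive zero the odd real-rooted polynomial `σ` lies below its tangent at `0`:
`σ(x)² = x² ∏ |r² - x²| ≤ x² ∏ r² = x² σ'(0)²`, over the nonzero roots `r`. -/
theorem abs_discPoly_le {p q : ℕ} (hq : Odd q) (hpq : Nat.Coprime p q) {x : ℝ} (hx : 0 < x)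
    (hr : ∀ r, 0 < r → r < x → (discPoly p q).eval r ≠ 0) :
    |(discPoly p q).eval x| ≤ |(discPoly p q).derivative.eval 0| * x := by
  obtain ⟨s, -, hs⟩ := exists_real_roots hq hpq (c := 0) (by norm_num)
  rw [C_0, sub_zero] at hs
  have hneg := discPoly_eval_neg hq hpq
  have hder := discPoly_derivative_ne_zero hq hpq
  have h0 : (0 : ℝ) ∈ s := by
    have : (discPoly p q).roots = s := by rw [hs, roots_multiset_prod_X_sub_C]
    rw [← this, mem_roots (discPoly_monic p hq.pos).ne_zero]
    exact discPoly_eval_zero hq hpq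
  obtain ⟨t, rfl⟩ := Multiset.exists_cons_of_mem h0
  rw [Multiset.map_cons, Multiset.prod_cons, C_0, sub_zero] at hs
  set D := discPoly p q
  set Q := (t.map fun r => X - C r).prod with hQ
  have hDQ : ∀ y, D.eval y = y * Q.eval y := fun y => by rw [hs, eval_mul, eval_X]
  have hQ0 : D.derivative.eval 0 = Q.eval 0 := by
    rw [hs, derivative_mul, derivative_X, one_mul, eval_add, eval_mul, eval_X, zero_mul, add_zero]
  have hQprod : ∀ y, Q.eval y = (t.map fun r => y - r).prod := by
    intro y
    rw [hQ, eval_multiset_prod, Multiset.map_map]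
    simp
  have heven : Q.eval (-x) = Q.eval x := by
    have := hneg x
    rw [hDQ, hDQ] at this
    have : x * (Q.eval (-x) - Q.eval x) = 0 := by linarith
    linarith [(mul_eq_zero.1 this).resolve_left hx.ne']
  have hroot : ∀ r ∈ t, x ≤ |r| := by
    intro r hrt
    have hQr : Q.eval r = 0 := by
      rw [hQprod]
      exact Multiset.prod_eq_zero (Multiset.mem_map.2 ⟨r, hrt, sub_self r⟩)
    have hr0 : r ≠ 0 := by
      rintro rfl
      exact hder (hQ0.trans hQr)
    by_contra! hlt
    refine hr |r| (abs_pos.2 hr0) hlt ?_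
    rcases abs_choice r with h | h
    · rw [h, hDQ, hQr, mul_zero]
    · rw [h, hneg, hDQ, hQr, mul_zero, neg_zero]
  have hsq : (Q.eval x) ^ 2 ≤ (Q.eval 0) ^ 2 := by
    calc (Q.eval x) ^ 2 = Q.eval x * Q.eval (-x) := by rw [heven, sq]
      _ = (t.map fun r => (x - r) * (-x - r)).prod := by
        rw [hQprod, hQprod, Multiset.prod_map_mul]
      _ ≤ (t.map fun r => (0 - r) * (0 - r)).prod := by
        refine Multiset.prod_map_le_prod_map₀ _ _ (fun r hr => ?_) fun r hr => ?_
        · have := sq_abs r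
          have := hroot r hr
          nlinarith
        · nlinarith
      _ = (Q.eval 0) ^ 2 := by rw [Multiset.prod_map_mul, ← hQprod, sq]
  rw [hQ0, hDQ, abs_mul, abs_of_pos hx, mul_comm]
  exact mul_le_mul_of_nonneg_right (sq_le_sq.1 hsq) hx.le

theorem abs_discPoly_le_four {p q : ℕ} (hq : Odd q) (hpq : Nat.Coprime p q) {x : ℝ}
    (hx : |x| ≤ 4 / |(discPoly p q).derivative.eval 0|) : |(discPoly p q).eval x| ≤ 4 := by
  have hder := abs_pos.2 (discPoly_derivative_ne_zero hq hpq)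
  rw [le_div_iff₀ hder] at hx
  have hpos : ∀ y, 0 < y → y * |(discPoly p q).derivative.eval 0| ≤ 4 →
      |(discPoly p q).eval y| ≤ 4 := by
    intro y hy hy4
    by_cases hr : ∀ r, 0 < r → r < y → (discPoly p q).eval r ≠ 0
    · have := abs_discPoly_le hq hpq hy hr
      linarith
    -- Between `0` and the first positive zero `r` there is a critical point; the modulus
    -- there is at least `4`, contradicting the tangent bound.
    · exfalso
      push Not at hr
      obtain ⟨r₁, h1, h2, h3⟩ := hr
      classical
      have hmem : ∀ r, r ∈ (discPoly p q).roots.toFinset.filter (0 < ·) ↔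
          (discPoly p q).eval r = 0 ∧ 0 < r := by
        intro r
        rw [mem_filter, Multiset.mem_toFinset, mem_roots (discPoly_monic p hq.pos).ne_zero,
          IsRoot.def]
      have hne : ((discPoly p q).roots.toFinset.filter (0 < ·)).Nonempty :=
        ⟨r₁, (hmem r₁).2 ⟨h3, h1⟩⟩
      set r := ((discPoly p q).roots.toFinset.filter (0 < ·)).min' hne
      obtain ⟨hr0, hrpos⟩ := (hmem r).1 (min'_mem _ hne)
      have hrr : r ≤ r₁ := min'_le _ _ ((hmem r₁).2 ⟨h3, h1⟩)
      obtain ⟨c, hc, hc0⟩ := exists_deriv_eq_zero hrpos (f := fun y => (discPoly p q).eval y)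
        (discPoly p q).continuous.continuousOn (by rw [discPoly_eval_zero hq hpq, hr0])
      rw [Polynomial.deriv] at hc0
      have h4 := four_le_abs_of_critical hq hpq hc0
      have h5 := abs_discPoly_le hq hpq hc.1 fun s hs hsc hs0 => by
        have := min'_le _ _ ((hmem s).2 ⟨hs0, hs⟩)
        have := hc.2
        linarith
      have := hc.2
      nlinarith
  rcases lt_trichotomy x 0 with h | rfl | h
  · rw [abs_of_neg h] at hx
    have := hpos (-x) (by linarith) hx
    rwa [discPoly_eval_neg hq hpq, abs_neg] at this
  · rw [discPoly_eval_zero hq hpq]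
    norm_num
  · rw [abs_of_pos h] at hx
    exact hpos x h hx

/-! ### Bloch solutions and the spectrum -/

/-- The basis vector at the site `n`. -/
noncomputable def site (n : ℤ) : Ell2 := lp.single 2 n (1 : ℂ)

theorem site_apply (n m : ℤ) : (site n : ∀ _ : ℤ, ℂ) m = if m = n then 1 else 0 := by
  rw [site, lp.single_apply, Pi.single_apply]

theorem norm_site (n : ℤ) : ‖site n‖ = 1 := by
  rw [site, lp.norm_single (by norm_num)]
  simp

theorem operator_site (α θ : ℝ) (n : ℤ) :
    operator α θ (site n) = site (n + 1) + site (n - 1) + (potential α θ n : ℂ) • site n := by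
  ext m
  rw [operator_apply]
  change _ = (site (n + 1) : ∀ _ : ℤ, ℂ) m + (site (n - 1) : ∀ _ : ℤ, ℂ) m
    + (potential α θ n : ℂ) * (site n : ∀ _ : ℤ, ℂ) m
  simp only [site_apply]
  have e1 : m - 1 = n ↔ m = n + 1 := sub_eq_iff_eq_add
  have e2 : m + 1 = n ↔ m = n - 1 := eq_sub_iff_add_eq.symm
  simp only [e1, e2]
  congr 1
  by_cases h : m = n
  · rw [h, potential]
  · simp [h]

/-- A truncated generalized eigenfunction. -/
noncomputable def truncation (φ : ℕ → ℂ) (M : ℕ) : Ell2 :=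
  ∑ k ∈ range M, φ (k + 1) • site ((k : ℤ) + 1)

theorem operator_truncation {α θ : ℝ} {E : ℂ} {φ : ℕ → ℂ}
    (hrec : ∀ k, φ (k + 2) = (E - (potential α θ (k + 1 : ℕ) : ℂ)) * φ (k + 1) - φ k) (M : ℕ) :
    E • truncation φ M - operator α θ (truncation φ M)
      = φ 0 • site 1 - φ 1 • site 0 + φ (M + 1) • site M - φ M • site (M + 1) := by
  induction M with
  | zero =>
    simp [truncation]
  | succ M ih =>
    have e : truncation φ (M + 1) = truncation φ M + φ (M + 1) • site ((M : ℤ) + 1) :=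
      sum_range_succ _ _
    have h1 : E • truncation φ M = operator α θ (truncation φ M)
      + (φ 0 • site 1 - φ 1 • site 0 + φ (M + 1) • site M - φ M • site (M + 1)) :=
      sub_eq_iff_eq_add'.1 ih
    rw [e, map_add, map_smul, operator_site, smul_add, h1, hrec M]
    push_cast
    rw [show ((M : ℤ) + 1 - 1) = M by ring]
    module

theorem norm_truncation_sq (φ : ℕ → ℂ) (M : ℕ) :
    ‖truncation φ M‖ ^ 2 = ∑ k ∈ range M, ‖φ (k + 1)‖ ^ 2 := by
  let s := (range M).map ⟨fun k : ℕ => (k : ℤ) + 1, fun a b h => by simpa using h⟩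
  have e : ∀ k : ℕ, ((k : ℤ) + 1).toNat = k + 1 := fun k => by omega
  have h : ‖∑ i ∈ s, lp.single 2 i (φ i.toNat)‖ ^ (2 : ℝ≥0∞).toReal
      = ∑ i ∈ s, ‖φ i.toNat‖ ^ (2 : ℝ≥0∞).toReal :=
    lp.norm_sum_single (E := fun _ : ℤ => ℂ) (by norm_num) (fun i => φ i.toNat) s
  have h1 : truncation φ M = ∑ i ∈ s, lp.single 2 i (φ i.toNat) := by
    rw [sum_map]
    refine sum_congr rfl fun k _ => ?_
    rw [site, ← lp.single_smul, smul_eq_mul, mul_one]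
    exact congrArg (fun n => lp.single (E := fun _ : ℤ => ℂ) 2 ((k : ℤ) + 1) (φ n)) (e k).symm
  have h2 : ∑ k ∈ range M, ‖φ (k + 1)‖ ^ 2 = ∑ i ∈ s, ‖φ i.toNat‖ ^ 2 := by
    rw [sum_map]
    refine sum_congr rfl fun k _ => ?_
    exact congrArg (fun n => ‖φ n‖ ^ 2) (e k).symm
  rw [h1, h2]
  simpa only [ENNReal.toReal_ofNat, Real.rpow_ofNat] using h

/-- A Bloch solution with a multiplier of modulus one puts its energy into the spectrum: its
truncations are approximate eigenvectors. -/
theorem mem_spectrum_of_bloch {α θ : ℝ} {E z : ℂ} {q : ℕ} (hq : 0 < q) (hz : ‖z‖ = 1) {φ : ℕ → ℂ}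
    (h0 : φ 0 ≠ 0 ∨ φ 1 ≠ 0)
    (hrec : ∀ k, φ (k + 2) = (E - (potential α θ (k + 1 : ℕ) : ℂ)) * φ (k + 1) - φ k)
    (hper : ∀ k, φ (k + q) = z * φ k) : E ∈ spectrum ℂ (operator α θ) := by
  rw [spectrum.mem_iff]
  rintro ⟨u, hu⟩
  set B : Ell2 →L[ℂ] Ell2 := ↑u⁻¹
  have hB : ∀ f, ‖f‖ ≤ ‖B‖ * ‖E • f - operator α θ f‖ := by
    intro f
    have h1 : B (E • f - operator α θ f) = f := by
      have : (B * (algebraMap ℂ (Ell2 →L[ℂ] Ell2) E - operator α θ)) f = f := by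
        rw [← hu, Units.inv_mul]
        rfl
      simpa [Algebra.algebraMap_eq_smul_one] using this
    calc ‖f‖ = ‖B (E • f - operator α θ f)‖ := by rw [h1]
      _ ≤ _ := B.le_opNorm _
  have hnorm : ∀ N k, ‖φ (k + q * N)‖ = ‖φ k‖ := by
    intro N k
    induction N with
    | zero => simp
    | succ N ih => rw [mul_add, mul_one, ← add_assoc, hper, norm_mul, hz, one_mul, ih]
  set s := ∑ k ∈ range q, ‖φ (k + 1)‖ ^ 2 with hs
  have hspos : 0 < s := by
    refine lt_of_le_of_ne (sum_nonneg fun _ _ => by positivity) fun h => ?_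
    rw [hs, eq_comm, sum_eq_zero_iff_of_nonneg fun n _ => by positivity] at h
    have hv : ∀ n < q, φ (n + 1) = 0 := fun n hn => by simpa using h n (mem_range.2 hn)
    have h1 : φ 1 = 0 := hv 0 hq
    have h2 : φ 0 = 0 := by
      have h3 := hnorm 1 0
      have h4 := hv (q - 1) (by omega)
      rw [Nat.sub_add_cancel hq] at h4
      rw [zero_add, mul_one, h4, norm_zero] at h3
      exact norm_eq_zero.1 h3.symm
    tauto
  have hsum : ∀ N : ℕ, ∑ k ∈ range (q * N), ‖φ (k + 1)‖ ^ 2 = N * s := by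
    intro N
    induction N with
    | zero => simp
    | succ N ih =>
      have : ∀ k ∈ range q, ‖φ (q * N + k + 1)‖ ^ 2 = ‖φ (k + 1)‖ ^ 2 := fun k _ => by
        rw [← hnorm N (k + 1), show q * N + k + 1 = k + 1 + q * N by ring]
      rw [mul_add, mul_one, sum_range_add, ih, sum_congr rfl this]
      push_cast
      ring
  have hres : ∀ N : ℕ, ‖E • truncation φ (q * N) - operator α θ (truncation φ (q * N))‖
      ≤ 2 * (‖φ 0‖ + ‖φ 1‖) := by
    intro N
    rw [operator_truncation hrec]
    have n1 := hnorm N 0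
    have n2 := hnorm N 1
    rw [zero_add] at n1
    rw [add_comm] at n2
    calc _ ≤ ‖φ 0 • site 1‖ + ‖φ 1 • site 0‖ + ‖φ (q * N + 1) • site (q * N : ℕ)‖
          + ‖φ (q * N) • site ((q * N : ℕ) + 1)‖ :=
          (norm_sub_le _ _).trans (add_le_add_left ((norm_add_le _ _).trans
            (add_le_add_left (norm_sub_le _ _) _)) _)
      _ = _ := by
        simp only [norm_smul, norm_site, mul_one, n1, n2]
        ring
  obtain ⟨N, hN⟩ := exists_nat_gt ((‖B‖ * (2 * (‖φ 0‖ + ‖φ 1‖))) ^ 2 / s)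
  rw [div_lt_iff₀ hspos, ← hsum, ← norm_truncation_sq] at hN
  have h1 := (hB (truncation φ (q * N))).trans
    (mul_le_mul_of_nonneg_left (hres N) (norm_nonneg B))
  have h2 := pow_le_pow_left₀ (norm_nonneg _) h1 2
  linarith

theorem abs_le_four_of_mem_S {α E : ℝ} (h : E ∈ S α) : |E| ≤ 4 := by
  obtain ⟨θ, -, hE⟩ := h
  have h1 := spectrum.norm_le_norm_mul_of_mem hE
  have h2 : ‖operator α θ‖ ≤ 4 := by
    have s1 : ∀ k, ‖shift k‖ ≤ 1 := fun k => LinearMap.mkContinuous_norm_le _ zero_le_one _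
    have s2 : ‖mulPotential α θ‖ ≤ 2 := LinearMap.mkContinuous_norm_le _ zero_le_two _
    calc ‖operator α θ‖ ≤ ‖shift (-1)‖ + ‖shift 1‖ + ‖mulPotential α θ‖ := norm_add₃_le
      _ ≤ 1 + 1 + 2 := by gcongr <;> exact s1 _
      _ = 4 := by norm_num
  have h3 : ‖(1 : Ell2 →L[ℂ] Ell2)‖ ≤ 1 := ContinuousLinearMap.norm_id_le
  rw [Complex.norm_real, Real.norm_eq_abs] at h1
  calc |E| ≤ _ := h1
    _ ≤ 4 * 1 := by gcongr
    _ = 4 := by norm_num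

theorem mem_S_of_abs_le_four {p q : ℕ} (hq : Odd q) (hpq : Nat.Coprime p q) {E : ℝ}
    (hE : |(discPoly p q).eval E| ≤ 4) : E ∈ S (p / q) := by
  have h : (discPoly p q).eval₂ Complex.ofRealHom (E : ℂ) = ((discPoly p q).eval E : ℝ) := by
    rw [← Complex.ofRealHom_eq_coe, eval₂_at_apply, Complex.ofRealHom_eq_coe]
  obtain ⟨θ, hθ, z, hz, φ, h0, hrec, hper⟩ := exists_bloch_of_abs_le_four hq hpq h hE
  refine ⟨θ, hθ, mem_spectrum_of_bloch hq.pos hz h0 (fun k => ?_) hper⟩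
  rw [hrec k, potential]
  push_cast
  rfl

theorem le_halfWidth {p q : ℕ} (hq : Odd q) (hpq : Nat.Coprime p q) :
    4 / |(discPoly p q).derivative.eval 0| ≤ halfWidth (p / q) := by
  set w := 4 / |(discPoly p q).derivative.eval 0|
  have hw : 0 ≤ w := by positivity
  have hsub : Set.Icc (-w) w ⊆ centralBand (p / q) := by
    refine isPreconnected_Icc.subset_connectedComponentIn ⟨by linarith, hw⟩ fun x hx => ?_
    exact mem_S_of_abs_le_four hq hpq (abs_discPoly_le_four hq hpq (abs_le.2 hx))
  have hbdd : Bornology.IsBounded (centralBand (p / q)) :=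
    (Metric.isBounded_Icc (-4 : ℝ) 4).subset
      ((connectedComponentIn_subset _ _).trans fun x hx => abs_le.1 (abs_le_four_of_mem_S hx))
  have hd := Metric.dist_le_diam_of_mem hbdd (hsub ⟨by linarith, le_rfl⟩)
    (hsub ⟨le_rfl, by linarith⟩)
  rw [Real.dist_eq, sub_neg_eq_add, abs_of_nonneg (by linarith)] at hd
  rw [halfWidth]
  linarith

/-! ### Assembly -/

theorem deriv_discriminant (p q : ℕ) :
    deriv (discriminant p q) 0 = -(discPoly p q).derivative.eval 0 := by
  have : discriminant p q = fun E => -(discPoly p q).eval E := funext (discriminant_eq p q)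
  rw [this, deriv.fun_neg, Polynomial.deriv]

theorem odd_num_add_den (a : ℕ → ℕ) (n : ℕ) (h : ∀ k, 1 ≤ k → k ≤ n → 0 < a k ∧ Even (a k)) :
    Odd ((cfrac a n).num + (cfrac a n).den) := by
  induction n generalizing a with
  | zero => simp [cfrac]
  | succ n ih =>
    obtain ⟨h0, h1⟩ := h 1 le_rfl (by omega)
    have ih := ih (fun k => a (k + 1)) fun k hk hkn => h (k + 1) (by omega) (by omega)
    obtain ⟨e1, e2⟩ := one_div_add_num_den h0 (cfrac_nonneg (fun k => a (k + 1)) n)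
    rw [cfrac, e1, e2]
    have h2 : Even ((a 1 : ℤ) * (cfrac (fun k => a (k + 1)) n).den) :=
      ((Int.even_coe_nat _).2 h1).mul_right _
    have := h2.add_odd ih
    convert this using 1
    ring

theorem odd_den (a : ℕ → ℕ) (n : ℕ) (h0 : Odd (a 1))
    (h : ∀ k, 2 ≤ k → k ≤ n + 1 → 0 < a k ∧ Even (a k)) : Odd (cfrac a (n + 1)).den := by
  have h1 := odd_num_add_den (fun k => a (k + 1)) n
    fun k hk hkn => h (k + 1) (by omega) (by omega)
  have e2 := (one_div_add_num_den h0.pos (cfrac_nonneg (fun k => a (k + 1)) n)).2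
  rw [← Int.odd_coe_nat, cfrac, e2]
  obtain ⟨m, hm⟩ := h0
  rw [hm]
  push_cast
  have : Even (2 * (m : ℤ) * (cfrac (fun k => a (k + 1)) n).den) := (even_two_mul _).mul_right _
  have := this.add_odd h1
  convert this using 1
  ring

/-- The bound on the slope, and the band width, in terms of the number of levels. -/
theorem slope_and_width (a : ℕ → ℕ) (n p q : ℕ) (h0 : Odd (a 1))
    (h : ∀ k, 2 ≤ k → k ≤ n + 1 → 0 < a k ∧ Even (a k)) (hq : 0 < q) (hpq : Nat.Coprime p q)
    (hcf : (p : ℚ) / (q : ℚ) = cfrac a (n + 1)) :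
    (cfrac a (n + 1)).den = q ∧ 0 < |deriv (discriminant p q) 0| ∧
      |deriv (discriminant p q) 0| ≤ 6 * 15 ^ n * (q : ℝ) ^ 4 ∧
      4 / |deriv (discriminant p q) 0| ≤ halfWidth ((p : ℝ) / (q : ℝ)) := by
  have hden : (cfrac a (n + 1)).den = q := by
    have := Rat.den_div_eq_of_coprime (a := p) (b := q) (by exact_mod_cast hq) (by simpa using hpq)
    rw [Int.cast_natCast, Int.cast_natCast, hcf] at this
    exact_mod_cast this
  have hodd : Odd q := hden ▸ odd_den a n h0 h
  have hα : ((cfrac a (n + 1) : ℚ) : ℝ) = p / q := by rw [← hcf]; push_cast; rfl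
  obtain ⟨m, hm⟩ := hodd
  have hodd : Odd q := ⟨m, hm⟩
  rw [deriv_discriminant, abs_neg]
  refine ⟨hden, abs_pos.2 (discPoly_derivative_ne_zero hodd hpq), ?_, le_halfWidth hodd hpq⟩
  have hsum := sum_oddProd_le a n h0 h m (hden.trans hm)
  have hder := chainPoly_derivative_eval_zero (x := cfrac a (n + 1)) m (by omega)
  rw [discPoly_eq_chainPoly hodd hpq, ← hα]
  rw [show chainPoly (cfrac a (n + 1)) q = chainPoly (cfrac a (n + 1)) (2 * m + 1) by rw [hm],
    hder, abs_mul, abs_pow, abs_neg, abs_one, one_pow, one_mul, abs_of_nonneg, ← hden]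
  · exact hsum
  · refine sum_nonneg fun i hi => ?_
    have := mem_range.1 hi
    have h1 : 0 < oddProd (cfrac a (n + 1) : ℚ) i := oddProd_pos (by omega)
    have h2 : 0 < evenProd (cfrac a (n + 1) : ℚ) m := evenProd_pos (by omega)
    have h3 : 0 < evenProd (cfrac a (n + 1) : ℚ) i := evenProd_pos (by omega)
    positivity

end AlmostMathieu

theorem lemma2 :
    -- the bounds for all `q`, with absolute constants
    (∃ C₁ C₂ : ℝ, 1 < C₁ ∧ C₁ < 14 ∧ 1 < C₂ ∧ C₂ < Real.exp 10 ∧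
      ∀ (a : ℕ → ℕ) (n p q : ℕ), 1 ≤ n →
        (∀ k, 1 ≤ k → k ≤ n → 0 < a k) →
        Odd (a 1) → (∀ k, 2 ≤ k → k ≤ n → Even (a k)) →
        0 < q → Nat.Coprime p q → (p : ℚ) / (q : ℚ) = AlmostMathieu.cfrac a n →
        |deriv (AlmostMathieu.discriminant p q) 0| < C₂ * (q : ℝ) ^ C₁ ∧
        4 / |deriv (AlmostMathieu.discriminant p q) 0|
          ≤ AlmostMathieu.halfWidth ((p : ℝ) / (q : ℝ)) ∧
        4 * C₂⁻¹ * (q : ℝ) ^ (-C₁) < 4 / |deriv (AlmostMathieu.discriminant p q) 0|) ∧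
    -- the improved bounds for large `q` under the growth condition on the denominators
    (∀ ν : ℝ, 1 < ν → ∀ ε : ℝ, 0 < ε → ∃ Q : ℝ,
      ∀ (a : ℕ → ℕ) (n p q : ℕ), 1 ≤ n →
        (∀ k, 1 ≤ k → k ≤ n → 0 < a k) →
        Odd (a 1) → (∀ k, 2 ≤ k → k ≤ n → Even (a k)) →
        0 < q → Nat.Coprime p q → (p : ℚ) / (q : ℚ) = AlmostMathieu.cfrac a n →
        (∀ k, 1 ≤ k → k + 1 ≤ n →
          (AlmostMathieu.convDen a k : ℝ) ^ ν ≤ (AlmostMathieu.convDen a (k + 1) : ℝ)) →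
        Q < (q : ℝ) →
        |deriv (AlmostMathieu.discriminant p q) 0|
          < (q : ℝ) ^ (5 + Real.eulerMascheroniConstant + ε) ∧
        4 * (q : ℝ) ^ (-(5 + Real.eulerMascheroniConstant + ε))
          < AlmostMathieu.halfWidth ((p : ℝ) / (q : ℝ))) := by
  constructor
  · refine ⟨8, 7, by norm_num, by norm_num, by norm_num, ?_, ?_⟩
    · have := Real.add_one_lt_exp (show (10 : ℝ) ≠ 0 by norm_num)
      linarith
    intro a n p q hn hpos h1 heven hq hpq hcf
    obtain ⟨n, rfl⟩ := Nat.exists_eq_succ_of_ne_zero (Nat.one_le_iff_ne_zero.1 hn)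
    have ha : ∀ k, 2 ≤ k → k ≤ n + 1 → 0 < a k ∧ Even (a k) :=
      fun k hk hkn => ⟨hpos k (by omega) hkn, heven k hk hkn⟩
    obtain ⟨hden, hd0, hle, hw⟩ := AlmostMathieu.slope_and_width a n p q h1 ha hq hpq hcf
    have h2 : ((2 ^ n : ℕ) : ℝ) ≤ q := by
      exact_mod_cast hden ▸ AlmostMathieu.two_pow_le_den a n h1.pos ha
    have hq0 : (0 : ℝ) < q := by exact_mod_cast hq
    have hlt : |deriv (AlmostMathieu.discriminant p q) 0| < 7 * (q : ℝ) ^ (8 : ℝ) := by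
      have h15 : (15 : ℝ) ^ n ≤ (q : ℝ) ^ 4 := by
        calc (15 : ℝ) ^ n ≤ 16 ^ n := by gcongr; norm_num
          _ = ((2 ^ n : ℕ) : ℝ) ^ 4 := by
            push_cast
            rw [← pow_mul, mul_comm, pow_mul]
            norm_num
          _ ≤ (q : ℝ) ^ 4 := by gcongr
      calc |deriv (AlmostMathieu.discriminant p q) 0| ≤ 6 * 15 ^ n * (q : ℝ) ^ 4 := hle
        _ ≤ 6 * (q : ℝ) ^ 4 * (q : ℝ) ^ 4 := by gcongr
        _ = 6 * (q : ℝ) ^ 8 := by ring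
        _ < 7 * (q : ℝ) ^ 8 := by gcongr; norm_num
        _ = 7 * (q : ℝ) ^ (8 : ℝ) := by norm_num
    refine ⟨hlt, hw, ?_⟩
    rw [Real.rpow_neg hq0.le, mul_assoc, ← mul_inv, ← div_eq_mul_inv]
    gcongr
  · intro ν hν ε hε
    obtain ⟨C, hC, hbound⟩ := AlmostMathieu.exists_pow_le_mul_den hν
    have hγ := Real.one_half_lt_eulerMascheroniConstant
    set s := Real.eulerMascheroniConstant + ε with hs
    have hs0 : 0 < s := by linarith
    refine ⟨(6 * C) ^ (1 / s), ?_⟩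
    intro a n p q hn hpos h1 heven hq hpq hcf hgrow hQ
    obtain ⟨n, rfl⟩ := Nat.exists_eq_succ_of_ne_zero (Nat.one_le_iff_ne_zero.1 hn)
    have ha : ∀ k, 2 ≤ k → k ≤ n + 1 → 0 < a k ∧ Even (a k) :=
      fun k hk hkn => ⟨hpos k (by omega) hkn, heven k hk hkn⟩
    obtain ⟨hden, hd0, hle, hw⟩ := AlmostMathieu.slope_and_width a n p q h1 ha hq hpq hcf
    have hq0 : (0 : ℝ) < q := by exact_mod_cast hq
    have h15 := hbound a n h1 ha hgrow
    rw [hden] at h15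
    have h6 : 6 * C < (q : ℝ) ^ s := by
      calc 6 * C = ((6 * C) ^ (1 / s)) ^ s := by
            rw [← Real.rpow_mul (by positivity), one_div_mul_cancel hs0.ne', Real.rpow_one]
        _ < (q : ℝ) ^ s := Real.rpow_lt_rpow (by positivity) hQ hs0
    have hlt : |deriv (AlmostMathieu.discriminant p q) 0|
        < (q : ℝ) ^ (5 + Real.eulerMascheroniConstant + ε) := by
      calc |deriv (AlmostMathieu.discriminant p q) 0| ≤ 6 * 15 ^ n * (q : ℝ) ^ 4 := hle
        _ ≤ 6 * (C * q) * (q : ℝ) ^ 4 := by gcongr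
        _ = (6 * C) * (q : ℝ) ^ 5 := by ring
        _ < (q : ℝ) ^ s * (q : ℝ) ^ 5 := by gcongr
        _ = (q : ℝ) ^ (5 + Real.eulerMascheroniConstant + ε) := by
          rw [← Real.rpow_natCast, ← Real.rpow_add hq0, hs]
          congr 1
          push_cast
          ring
    refine ⟨hlt, lt_of_lt_of_le ?_ hw⟩
    rw [Real.rpow_neg hq0.le, ← div_eq_mul_inv]
    gcongr
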